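/- Let $K$ be a unital commutative $\mathbb Q$-algebra, $z=(z_1,\dots,z_n)$ free variables which either all commute or do not commute with each other, $t$ a central parameter, and $\alpha\ge 1$. For a power series $u$ in $z$, $o(u)$ is the least degree in $z$ of a monomial of $u$. Write $\mathcal Der^{[\alpha]}$ for the Lie algebra of $K$-derivations of $K\langle\langle z\rangle\rangle$ which increase the degree in $z$ by at least $\alpha-1$, $\mathcal D^{[\alpha]}\langle\langle z\rangle\rangle\subset \mathrm{End}_K(K\langle\langle z\rangle\rangle)$ for the unital subalgebra generated by $\mathcal Der^{[\alpha]}$, $\mathcal U^{[\alpha]}$ for the universal enveloping algebra of $\mathcal Der^{[\alpha]}$ over $K$ with its Hopf algebra structure ($\Delta\delta=1\otimes\delta+\delta\otimes1$, $\epsilon(\delta)=0$, antipode $\delta\mapsto-\delta$ on $\mathcal Der^{[\alpha]}$), and $\rho:\mathcal U^{[\alpha]}\to\mathcal D^{[\alpha]}\langle\langle z\rangle\rangle$ for the canonical (surjective) homomorphism. For a vector $\vec u$ of power series, $[\vec u\,\frac{\partial}{\partial z}]$ is the derivation with $z_i\mapsto u_i$. Let $F_t$ be an automorphism of $K[[t]]\langle\langle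 z\rangle\rangle$ over $K[[t]]$ with $F_t(z)=z-H_t(z)$, $o(H_t)\ge\alpha$, $H_{t=0}=0$ (that is, $F_t\in\mathbb A_t^{[\alpha]}\langle\langle z\rangle\rangle$), and let $G_t=F_t^{-1}$, $G_t(z)=z+M_t(z)$. Then there are unique $\lambda_m,s_m\in\mathcal D^{[\alpha]}\langle\langle z\rangle\rangle$ ($m\ge0$, $\lambda_0=s_0=1$), a unique $a_t(z)\in K[[t]]\langle\langle z\rangle\rangle^{\times n}$ with $a_{t=0}=0$, $o(a_t)\ge\alpha$, and unique $\phi_m,\psi_m,\xi_m\in\mathcal Der^{[\alpha]}$ ($m\ge1$) such that, for all $u_t\in K[[t]]\langle\langle z\rangle\rangle$, $$\sum_{m\ge0}(-t)^m\lambda_m u_t(z)=u_t(F_t),\qquad \sum_{m\ge0}t^m s_m u_t(z)=u_t(G_t),$$ $$e^{[a_t\frac{\partial}{\partial z}]}z=F_t(z),\qquad d(t):=\sum_{m\ge1}\tfrac{t^m}{m}\phi_m=-\big[a_t\tfrac{\partial}{\partial z}\big],$$ $$h(t):=\sum_{m\ge1}t^{m-1}\psi_m=\big[\tfrac{\partial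 M_t}{\partial t}(F_t)\tfrac{\partial}{\partial z}\big],\qquad m(t):=\sum_{m\ge1}t^{m-1}\xi_m=\big[\tfrac{\partial H_t}{\partial t}(G_t)\tfrac{\partial}{\partial z}\big].$$ Put $f(t)=\sum t^m\lambda_m$, $g(t)=\sum t^m s_m$ and $\Omega_{F_t}=(f(t),g(t),d(t),h(t),m(t))$. Let $\mathcal N Sym=K\langle\Lambda_1,\Lambda_2,\dots\rangle$ be the free algebra, $\lambda(t)=1+\sum_{m\ge1}t^m\Lambda_m$, and let $\Pi=(\lambda(t),\sigma(t),\Phi(t),\psi(t),\xi(t))$ be given by $\sigma(t)=\lambda(-t)^{-1}=\sum_{m\ge 0} t^mS_m$, $e^{\Phi(t)}=\sigma(t)$ with $\Phi(t)=\sum_{m\ge1}\frac{t^m}{m}\Phi_m$, and $\sigma'(t)=\sigma(t)\psi(t)=\xi(t)\sigma(t)$ with $\psi(t)=\sum_{m\ge1}t^{m-1}\Psi_m$, $\xi(t)=\sum_{m\ge1}t^{m-1}\Xi_m$; $\mathcal N Sym$ is a Hopf algebra with all $\Psi_m$ primitive (equivalently $\Delta\Lambda_m=\sum_{i+j=m}\Lambda_i\otimes\Lambda_j$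 with $\Lambda_0=1$, and $\epsilon(\Lambda_m)=0$ for $m\ge1$). Then: (a) There is a unique $K$-Hopf algebra homomorphism $\mathcal T:\mathcal N Sym\to\mathcal U^{[\alpha]}$ such that $(\rho\circ \mathcal T)^{\times5}(\Pi)=\Omega_{F_t}$. For all $m\ge1$, $\rho(\mathcal T(\Lambda_m))=\lambda_m$ and $\rho(\mathcal T(S_m))=s_m$, and in $\mathcal U^{[\alpha]}$ we have $\mathcal T(\Psi_m)=\psi_m$, $\mathcal T(\Phi_m)=\phi_m$, $\mathcal T(\Xi_m)=\xi_m$. (b) There is a unique $K$-algebra homomorphism $\mathcal S_{F_t}:\mathcal N Sym\to\mathcal D^{[\alpha]}\langle\langle z\rangle\rangle$ with $\mathcal S_{F_t}^{\times5}(\Pi)=\Omega_{F_t}$, and $\Lambda_m\mapsto\lambda_m$, $S_m\mapsto s_m$, $\Psi_m\mapsto\psi_m$, $\Phi_m\mapsto\phi_m$, $\Xi_m\mapsto\xi_m$ for all $m\ge1$. It is compatible with any coproduct (algebra homomorphism $\mathcal D^{[\alpha]}\to\mathcal D^{[\alpha]}\otimes_K\mathcal D^{[\alpha]}$ with $\delta\mapsto1\otimes\delta+\delta\otimes1$),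 any counit (algebra homomorphism to $K$ with $\delta\mapsto0$) and any antipode (anti-endomorphism of $\mathcal D^{[\alpha]}$ with $\delta\mapsto-\delta$) on $\mathcal D^{[\alpha]}\langle\langle z\rangle\rangle$ that has these values on all $\delta\in\mathcal Der^{[\alpha]}$; so it is a $K$-Hopf algebra homomorphism whenever $\mathcal D^{[\alpha]}\langle\langle z\rangle\rangle$ has such a Hopf algebra structure. -/

import Mathlib

open scoped TensorProduct

noncomputable section

section Series

open Finset.HasAntidiagonal (antidiagonal mem_antidiagonal)

/-! ### Formal power series over an additive monoid with finite antidiagonals -/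

/-- The set of formal series `∑ w, u w • z ^ w`, where `w` runs through a monoid `M` of exponents. -/
def FormalSeries (M R : Type*) : Type _ := M → R

namespace FormalSeries

section Additive

variable {M R : Type*}

instance [AddCommGroup R] : AddCommGroup (FormalSeries M R) :=
  inferInstanceAs (AddCommGroup (M → R))

instance {S : Type*} [Semiring S] [AddCommGroup R] [Module S R] : Module S (FormalSeries M R) :=
  inferInstanceAs (Module S (M → R))

@[ext] theorem ext {u v : FormalSeries M R} (h : ∀ w, u w = v w) : u = v :=
  funext h

@[simp] theorem add_apply [AddCommGroup R] (u v : FormalSeries M R) (w : M) :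
    (u + v) w = u w + v w := rfl

@[simp] theorem zero_apply [AddCommGroup R] (w : M) : (0 : FormalSeries M R) w = 0 := rfl

@[simp] theorem smul_apply {S : Type*} [Semiring S] [AddCommGroup R] [Module S R] (c : S)
    (u : FormalSeries M R) (w : M) : (c • u) w = c • u w := rfl

open Classical in
/-- The monomial `r • z ^ w`. -/
def monomial [Zero R] (w : M) (r : R) : FormalSeries M R := fun w' => if w' = w then r else 0

end Additive

section Multiplicative

variable {M R : Type*} [AddMonoid M] [CommRing R]

instance : One (FormalSeries M R) := ⟨monomial 0 1⟩

theorem one_apply (w : M) [Decidable (w = 0)] :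
    (1 : FormalSeries M R) w = if w = 0 then 1 else 0 := by
  change monomial 0 1 w = _
  unfold monomial
  congr

variable [Finset.HasAntidiagonal M]

/-- The convolution product of two formal series. -/
instance : Mul (FormalSeries M R) :=
  ⟨fun u v w => ∑ p ∈ antidiagonal w, u p.1 * v p.2⟩

theorem mul_apply (u v : FormalSeries M R) (w : M) :
    (u * v) w = ∑ p ∈ antidiagonal w, u p.1 * v p.2 := rfl

theorem assoc_aux (a b c : FormalSeries M R) : a * b * c = a * (b * c) := by
  ext w
  simp only [mul_apply, Finset.sum_mul, Finset.mul_sum, Finset.sum_sigma']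
  refine Finset.sum_nbij' (fun x => ⟨(x.2.1, x.2.2 + x.1.2), (x.2.2, x.1.2)⟩)
    (fun x => ⟨(x.1.1 + x.2.1, x.2.2), (x.1.1, x.2.1)⟩) ?_ ?_ ?_ ?_ ?_
  · rintro ⟨⟨i, j⟩, ⟨k, l⟩⟩ h
    simp only [Finset.mem_sigma, mem_antidiagonal] at h ⊢
    obtain ⟨h1, h2⟩ := h
    exact ⟨by rw [← h1, ← h2, add_assoc], trivial⟩
  · rintro ⟨⟨i, j⟩, ⟨k, l⟩⟩ h
    simp only [Finset.mem_sigma, mem_antidiagonal] at h ⊢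
    obtain ⟨h1, h2⟩ := h
    exact ⟨by rw [← h1, ← h2, add_assoc], trivial⟩
  · rintro ⟨⟨i, j⟩, ⟨k, l⟩⟩ h
    simp only [Finset.mem_sigma, mem_antidiagonal] at h
    obtain ⟨h1, rfl⟩ := h
    rfl
  · rintro ⟨⟨i, j⟩, ⟨k, l⟩⟩ h
    simp only [Finset.mem_sigma, mem_antidiagonal] at h
    obtain ⟨h1, rfl⟩ := h
    rfl
  · rintro ⟨⟨i, j⟩, ⟨k, l⟩⟩ h
    simp only [mul_assoc]

theorem one_mul_aux (a : FormalSeries M R) : 1 * a = a := by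
  classical
  ext w
  rw [mul_apply, Finset.sum_eq_single (0, w)]
  · simp [one_apply]
  · rintro ⟨i, j⟩ h hne
    rw [mem_antidiagonal] at h
    have : i ≠ 0 := by
      rintro rfl
      exact hne (by simpa using h)
    simp [one_apply, this]
  · intro h
    exact absurd (by simp) h

theorem mul_one_aux (a : FormalSeries M R) : a * 1 = a := by
  classical
  ext w
  rw [mul_apply, Finset.sum_eq_single (w, 0)]
  · simp [one_apply]
  · rintro ⟨i, j⟩ h hne
    rw [mem_antidiagonal] at h
    have : j ≠ 0 := by
      rintro rfl
      exact hne (by simpa using h)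
    simp [one_apply, this]
  · intro h
    exact absurd (by simp) h

instance : Ring (FormalSeries M R) where
  __ := (inferInstance : AddCommGroup (FormalSeries M R))
  mul_assoc := assoc_aux
  one_mul := one_mul_aux
  mul_one := mul_one_aux
  left_distrib a b c := by
    ext w; simp only [mul_apply, add_apply, mul_add, Finset.sum_add_distrib]
  right_distrib a b c := by
    ext w; simp only [mul_apply, add_apply, add_mul, Finset.sum_add_distrib]
  zero_mul a := by ext w; simp [mul_apply]
  mul_zero a := by ext w; simp [mul_apply]

instance : Algebra R (FormalSeries M R) :=
  Algebra.ofModule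
    (fun r a b => by ext w; simp only [mul_apply, smul_apply, Finset.smul_sum, smul_mul_assoc])
    (fun r a b => by ext w; simp only [mul_apply, smul_apply, Finset.smul_sum, mul_smul_comm])

end Multiplicative

/-- For `M = σ →₀ ℕ` the product is that of Mathlib's `MvPowerSeries`. -/
theorem mul_eq_mvPowerSeries_mul {σ R : Type*} [DecidableEq σ] [CommRing R]
    (u v : FormalSeries (σ →₀ ℕ) R) :
    u * v = (show MvPowerSeries σ R from u) * (show MvPowerSeries σ R from v) := by
  funext w
  have := MvPowerSeries.coeff_mul w (show MvPowerSeries σ R from u) (show MvPowerSeries σ R from v)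
  rw [mul_apply]
  refine Eq.trans ?_ this.symm
  rfl

end FormalSeries

end Series

/-! ### Commutative and noncommutative free variables -/

/-- The antidiagonal of a word: all the ways of cutting it into a prefix and a suffix. -/
instance {X : Type*} : Finset.HasAntidiagonal (FreeAddMonoid X) where
  antidiagonal w :=
    letI := Classical.decEq (FreeAddMonoid X)
    (Finset.range (w.toList.length + 1)).image
      fun k => (FreeAddMonoid.ofList (w.toList.take k), FreeAddMonoid.ofList (w.toList.drop k))
  mem_antidiagonal {w p} := by
    obtain ⟨a, b⟩ := p
    simp only [Finset.mem_image, Finset.mem_range, Prod.mk.injEq]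
    constructor
    · rintro ⟨k, -, rfl, rfl⟩
      rw [← FreeAddMonoid.ofList_append, List.take_append_drop, FreeAddMonoid.ofList_toList]
    · rintro rfl
      refine ⟨a.toList.length, ?_, ?_, ?_⟩ <;> simp

/-- The free variables either commute with each other or do not. -/
inductive VarKind
  | commutative
  | noncommutative

/-- The monomials in `n` free variables (written additively): multi-indices in the commutative
case, words in the noncommutative case. -/
def Mon : VarKind → ℕ → Type
  | .commutative, n => Fin n →₀ ℕ
  | .noncommutative, n => FreeAddMonoid (Fin n)

namespace Mon

instance : ∀ (k : VarKind) (n : ℕ), AddMonoid (Mon k n)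
  | .commutative, n => inferInstanceAs (AddMonoid (Fin n →₀ ℕ))
  | .noncommutative, n => inferInstanceAs (AddMonoid (FreeAddMonoid (Fin n)))

instance : ∀ (k : VarKind) (n : ℕ), Finset.HasAntidiagonal (Mon k n)
  | .commutative, n => inferInstanceAs (Finset.HasAntidiagonal (Fin n →₀ ℕ))
  | .noncommutative, n => inferInstanceAs (Finset.HasAntidiagonal (FreeAddMonoid (Fin n)))

/-- The total degree of a monomial. -/
def degree : ∀ {k : VarKind} {n : ℕ}, Mon k n → ℕ
  | .commutative, n => fun w : Fin n →₀ ℕ => ∑ i, w i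
  | .noncommutative, n => fun w : FreeAddMonoid (Fin n) => w.length

/-- The monomial consisting of the single variable `z i`. -/
def var : ∀ {k : VarKind} {n : ℕ}, Fin n → Mon k n
  | .commutative, _, i => Finsupp.single i 1
  | .noncommutative, _, i => FreeAddMonoid.of i

end Mon

/-- `K⟨⟨z⟩⟩`: the formal power series in `n` commuting (resp. noncommuting) variables. -/
abbrev Zser (k : VarKind) (n : ℕ) (K : Type*) := FormalSeries (Mon k n) K

/-- `K[[t]]⟨⟨z⟩⟩`: the formal power series in `z` with coefficients in `K[[t]]`. -/
abbrev Zsert (k : VarKind) (n : ℕ) (K : Type*) := Zser k n (PowerSeries K)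

section Zser

variable {k : VarKind} {n : ℕ} {R : Type*} [CommRing R]

/-- The variable `z i` as a formal power series. -/
def zvar (i : Fin n) : Zser k n R := FormalSeries.monomial (Mon.var i) 1

/-- `OrdGE m u` says `o(u) ≥ m`: all monomials of degree less than `m` have coefficient zero. -/
def OrdGE (m : ℕ) (u : Zser k n R) : Prop := ∀ w : Mon k n, w.degree < m → u w = 0

/-- The coefficient of `t ^ m` in a series of `K[[t]]⟨⟨z⟩⟩ = K⟨⟨z⟩⟩[[t]]`. -/
def coeffT (m : ℕ) (u : Zsert k n R) : Zser k n R := fun w => PowerSeries.coeff m (u w)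

/-- The partial derivative `∂ / ∂t` on `K[[t]]⟨⟨z⟩⟩`. -/
def derivT (u : Zsert k n R) : Zsert k n R := fun w => PowerSeries.derivative R (u w)

end Zser

/-! ### Power series in a central parameter `t` over a noncommutative algebra -/

section TSeries

variable {A : Type*} [Ring A]

/-- `f(-t)`. -/
def negT (f : PowerSeries A) : PowerSeries A :=
  PowerSeries.mk fun m => (-1) ^ m * PowerSeries.coeff m f

/-- The derivative `d f(t) / dt`. -/
def ddt (f : PowerSeries A) : PowerSeries A :=
  PowerSeries.mk fun m => ((m : A) + 1) * PowerSeries.coeff (m + 1) f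

variable {K : Type*} [CommRing K] [Algebra K A]

/-- The substitution `p(x) = ∑ j, p_j x ^ j` of `x ∈ t A[[t]]` into `p ∈ K[[X]]`. As `x` has no
constant term, only the powers `x ^ j` with `j ≤ m` contribute to the coefficient of `t ^ m`. -/
def evalT (p : PowerSeries K) (x : PowerSeries A) : PowerSeries A :=
  PowerSeries.mk fun m => ∑ j ∈ Finset.range (m + 1),
    PowerSeries.coeff j p • PowerSeries.coeff m (x ^ j)

variable (K) [Algebra ℚ K]

/-- The exponential `e ^ d(t)` of a series `d(t)` without constant term. -/
def expT (d : PowerSeries A) : PowerSeries A := evalT (PowerSeries.exp K) d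

/-- The logarithm of a series `g(t)` with constant term `1`. -/
def logT (g : PowerSeries A) : PowerSeries A := evalT (PowerSeries.log K) (g - 1)

end TSeries

section TSeriesFacts

variable {A : Type*} [Ring A]

theorem coeff_pow_eq_zero {x : PowerSeries A} (hx : PowerSeries.constantCoeff x = 0) {m j : ℕ}
    (h : m < j) : PowerSeries.coeff m (x ^ j) = 0 := by
  induction j generalizing m with
  | zero => omega
  | succ j ih =>
    rw [pow_succ, PowerSeries.coeff_mul]
    refine Finset.sum_eq_zero fun p hp => ?_
    have hp' := Finset.HasAntidiagonal.mem_antidiagonal.1 hp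
    rcases Nat.lt_or_ge p.1 j with h1 | h1
    · rw [ih h1, zero_mul]
    · have : p.2 = 0 := by omega
      rw [this, PowerSeries.coeff_zero_eq_constantCoeff_apply, hx, mul_zero]

variable {K : Type*} [CommRing K] [Algebra K A]

theorem coeff_evalT_def (p : PowerSeries K) (x : PowerSeries A) (m : ℕ) :
    PowerSeries.coeff m (evalT p x) = ∑ j ∈ Finset.range (m + 1),
      PowerSeries.coeff j p • PowerSeries.coeff m (x ^ j) :=
  PowerSeries.coeff_mk _ _

theorem coeff_evalT (p : PowerSeries K) {x : PowerSeries A}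
    (hx : PowerSeries.constantCoeff x = 0) {m N : ℕ} (h : m < N) :
    PowerSeries.coeff m (evalT p x) =
      ∑ j ∈ Finset.range N, PowerSeries.coeff j p • PowerSeries.coeff m (x ^ j) := by
  rw [evalT, PowerSeries.coeff_mk]
  refine Finset.sum_subset (fun i hi => ?_) (fun i _ hi => ?_)
  · simp only [Finset.mem_range] at hi ⊢; omega
  · rw [coeff_pow_eq_zero hx, smul_zero]
    simp only [Finset.mem_range] at hi; omega

theorem evalT_one (x : PowerSeries A) : evalT (1 : PowerSeries K) x = 1 := by
  ext m
  rw [evalT, PowerSeries.coeff_mk, Finset.sum_eq_single 0]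
  · simp
  · intro j _ hj
    simp [PowerSeries.coeff_one, hj]
  · simp

theorem evalT_mul (p q : PowerSeries K) {x : PowerSeries A}
    (hx : PowerSeries.constantCoeff x = 0) : evalT (p * q) x = evalT p x * evalT q x := by
  ext m
  rw [PowerSeries.coeff_mul]
  have h1 : ∀ a ∈ Finset.HasAntidiagonal.antidiagonal m,
      PowerSeries.coeff a.1 (evalT p x) * PowerSeries.coeff a.2 (evalT q x) =
      ∑ i ∈ Finset.range (m + 1), ∑ j ∈ Finset.range (m + 1),
        (PowerSeries.coeff i p * PowerSeries.coeff j q) •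
          (PowerSeries.coeff a.1 (x ^ i) * PowerSeries.coeff a.2 (x ^ j)) := by
    intro a ha
    have ha' := Finset.HasAntidiagonal.mem_antidiagonal.1 ha
    rw [coeff_evalT p hx (N := m + 1) (by omega), coeff_evalT q hx (N := m + 1) (by omega),
      Finset.sum_mul_sum]
    refine Finset.sum_congr rfl fun i _ => Finset.sum_congr rfl fun j _ => ?_
    rw [smul_mul_smul_comm]
  rw [Finset.sum_congr rfl h1, Finset.sum_comm]
  simp_rw [Finset.sum_comm (s := Finset.HasAntidiagonal.antidiagonal m)]
  simp_rw [← Finset.smul_sum, ← PowerSeries.coeff_mul, ← pow_add]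
  rw [evalT, PowerSeries.coeff_mk]
  simp_rw [PowerSeries.coeff_mul, Finset.sum_smul]
  rw [← Finset.sum_product', Finset.sum_sigma']
  refine Finset.sum_of_injOn (fun y => y.2) ?_ ?_ ?_ ?_
  · rintro ⟨j, a, b⟩ h ⟨j', a', b'⟩ h' hh
    simp only [Finset.coe_sigma, Set.mem_sigma_iff, Finset.mem_coe,
      Finset.HasAntidiagonal.mem_antidiagonal] at h h' hh
    obtain ⟨rfl, rfl⟩ := Prod.mk.inj hh
    obtain ⟨-, rfl⟩ := h
    obtain ⟨-, rfl⟩ := h'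
    rfl
  · rintro ⟨j, a, b⟩ h
    simp only [Finset.coe_sigma, Set.mem_sigma_iff, Finset.mem_coe, Finset.mem_range,
      Finset.HasAntidiagonal.mem_antidiagonal, Finset.coe_product, Set.mem_prod] at h ⊢
    omega
  · rintro ⟨a, b⟩ h hh
    rw [coeff_pow_eq_zero hx, smul_zero]
    by_contra hlt
    refine hh ⟨⟨a + b, a, b⟩, ?_, rfl⟩
    simp only [Finset.coe_sigma, Set.mem_sigma_iff, Finset.mem_coe, Finset.mem_range,
      Finset.HasAntidiagonal.mem_antidiagonal]
    exact ⟨by omega, trivial⟩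
  · rintro ⟨j, a, b⟩ h
    simp only [Finset.mem_sigma, Finset.HasAntidiagonal.mem_antidiagonal] at h
    rw [← h.2]

theorem evalT_pow (p : PowerSeries K) {x : PowerSeries A}
    (hx : PowerSeries.constantCoeff x = 0) (j : ℕ) : evalT (p ^ j) x = evalT p x ^ j := by
  induction j with
  | zero => simp [evalT_one]
  | succ j ih => rw [pow_succ, evalT_mul _ _ hx, ih, pow_succ]

theorem constantCoeff_evalT (p : PowerSeries K) (x : PowerSeries A)
    (hp : PowerSeries.constantCoeff p = 0) : PowerSeries.constantCoeff (evalT p x) = 0 := by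
  rw [← PowerSeries.coeff_zero_eq_constantCoeff_apply, evalT, PowerSeries.coeff_mk]
  simp [hp]

theorem evalT_evalT (p q : PowerSeries K) (hq : PowerSeries.constantCoeff q = 0)
    {x : PowerSeries A} (hx : PowerSeries.constantCoeff x = 0) :
    evalT p (evalT q x) = evalT (evalT p q) x := by
  ext m
  rw [coeff_evalT_def, coeff_evalT_def]
  have h2 : ∀ j ∈ Finset.range (m + 1),
      PowerSeries.coeff j (evalT p q) • PowerSeries.coeff m (x ^ j) =
      ∑ i ∈ Finset.range (m + 1), (PowerSeries.coeff i p * PowerSeries.coeff j (q ^ i)) •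
        PowerSeries.coeff m (x ^ j) := by
    intro j hj
    rw [coeff_evalT p hq (N := m + 1) (Finset.mem_range.1 hj), Finset.sum_smul]
    rfl
  rw [Finset.sum_congr rfl h2, Finset.sum_comm]
  refine Finset.sum_congr rfl fun i _ => ?_
  rw [← evalT_pow q hx, coeff_evalT_def, Finset.smul_sum]
  simp_rw [mul_smul]

theorem evalT_eq_subst (p q : PowerSeries K) (hq : PowerSeries.constantCoeff q = 0) :
    evalT p q = p.subst q := by
  ext m
  rw [PowerSeries.coeff_subst' (PowerSeries.HasSubst.of_constantCoeff_zero' hq), evalT,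
    PowerSeries.coeff_mk]
  rw [finsum_eq_sum_of_support_subset _ (s := Finset.range (m + 1))]
  intro j hj
  by_contra hlt
  simp only [Finset.coe_range, Set.mem_Iio, not_lt] at hlt
  exact hj (by simp only []; rw [coeff_pow_eq_zero hq (by omega), smul_zero])

variable [Algebra ℚ K]

theorem evalT_exp_log : evalT (PowerSeries.exp K) (PowerSeries.log K) = 1 + PowerSeries.X := by
  set y : PowerSeries K := evalT (PowerSeries.exp K) (PowerSeries.log K) with hy
  have hsub := evalT_eq_subst (PowerSeries.exp K) (PowerSeries.log K) (by simp)
  have hd : PowerSeries.derivative K y = y * PowerSeries.derivative K (PowerSeries.log K) := by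
    rw [hy, hsub, PowerSeries.derivative_subst PowerSeries.HasSubst.log,
      PowerSeries.derivative_exp]
  have hlog : (1 + PowerSeries.X) * PowerSeries.derivative K (PowerSeries.log K) = 1 := by
    rw [PowerSeries.deriv_log]
    ext m
    rw [add_mul, one_mul, map_add]
    cases m with
    | zero => simp
    | succ m => simp [PowerSeries.coeff_succ_X_mul, PowerSeries.coeff_one, pow_succ]
  have hd' : (1 + PowerSeries.X) * PowerSeries.derivative K y = y := by
    rw [hd, mul_left_comm, hlog, mul_one]
  have h0 : PowerSeries.coeff 0 y = 1 := by
    rw [hy, evalT, PowerSeries.coeff_mk]; simp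
  have hrec : ∀ m : ℕ, PowerSeries.coeff (m + 1) y * ((m : K) + 1) +
      PowerSeries.coeff m y * m = PowerSeries.coeff m y := by
    intro m
    have := congrArg (PowerSeries.coeff m) hd'
    rw [add_mul, one_mul, map_add, PowerSeries.coeff_derivative] at this
    cases m with
    | zero => simpa using this
    | succ m =>
      rw [PowerSeries.coeff_succ_X_mul, PowerSeries.coeff_derivative] at this
      simpa using this
  have hinv : ∀ m : ℕ, ∀ c : K, c * ((m : K) + 1) = 0 → c = 0 := by
    intro m c hc
    have hu : ((m : K) + 1) * algebraMap ℚ K (1 / ((m : ℚ) + 1)) = 1 := by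
      have : ((m : K) + 1) = algebraMap ℚ K ((m : ℚ) + 1) := by simp
      rw [this, ← map_mul, mul_one_div_cancel (by positivity), map_one]
    calc c = c * ((m : K) + 1) * algebraMap ℚ K (1 / ((m : ℚ) + 1)) := by
          rw [mul_assoc, hu, mul_one]
      _ = 0 := by rw [hc, zero_mul]
  have h1 : PowerSeries.coeff 1 y = 1 := by
    have := hrec 0
    simpa [h0] using this
  have h2 : ∀ m : ℕ, PowerSeries.coeff (m + 2) y = 0 := by
    intro m
    induction m with
    | zero =>
      have := hrec 1
      rw [h1] at this
      exact hinv 1 _ (by simpa using this)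
    | succ m ih =>
      have := hrec (m + 2)
      rw [ih] at this
      exact hinv (m + 2) _ (by simpa using this)
  ext m
  match m with
  | 0 => rw [h0]; simp
  | 1 => rw [h1]; simp [PowerSeries.coeff_one, PowerSeries.coeff_X]
  | m + 2 => rw [h2]; simp [PowerSeries.coeff_one, PowerSeries.coeff_X]

theorem constantCoeff_logT (g : PowerSeries A) : PowerSeries.constantCoeff (logT K g) = 0 :=
  constantCoeff_evalT _ _ (by simp)

theorem expT_logT {g : PowerSeries A} (hg : PowerSeries.constantCoeff g = 1) :
    expT K (logT K g) = g := by
  have hx : PowerSeries.constantCoeff (g - 1) = 0 := by simp [hg]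
  rw [expT, logT, evalT_evalT _ _ (by simp) hx, evalT_exp_log]
  ext m
  rw [evalT, PowerSeries.coeff_mk]
  cases m with
  | zero => simp [hg]
  | succ m =>
    rw [Finset.sum_eq_single 1]
    · simp [PowerSeries.coeff_one, PowerSeries.coeff_X]
    · intro j _ hj
      rcases j with _ | j
      · simp [PowerSeries.coeff_one]
      · have : j ≠ 0 := by omega
        simp [PowerSeries.coeff_one, PowerSeries.coeff_X, this]
    · simp

end TSeriesFacts

/-! ### NCS systems -/

/-- A `5`-tuple `(f(t), g(t), d(t), h(t), m(t))` of power series over `A`. -/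
@[ext] structure FiveTuple (A : Type*) [Ring A] where
  f : PowerSeries A
  g : PowerSeries A
  d : PowerSeries A
  h : PowerSeries A
  m : PowerSeries A

namespace FiveTuple

/-- The map `S^{×5}` induced on `5`-tuples by an algebra homomorphism `S`. -/
def map {K A B : Type*} [CommRing K] [Ring A] [Ring B] [Algebra K A] [Algebra K B]
    (S : A →ₐ[K] B) (P : FiveTuple A) : FiveTuple B where
  f := PowerSeries.map S.toRingHom P.f
  g := PowerSeries.map S.toRingHom P.g
  d := PowerSeries.map S.toRingHom P.d
  h := PowerSeries.map S.toRingHom P.h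
  m := PowerSeries.map S.toRingHom P.m

/-- The defining equations of an NCS system. -/
structure IsNCS (K : Type*) {A : Type*} [CommRing K] [Algebra ℚ K] [Ring A] [Algebra K A]
    (P : FiveTuple A) : Prop where
  f_zero : PowerSeries.constantCoeff P.f = 1
  neg_f_mul_g : negT P.f * P.g = 1
  g_mul_neg_f : P.g * negT P.f = 1
  d_zero : PowerSeries.constantCoeff P.d = 0
  exp_d : expT K P.d = P.g
  ddt_g_eq_g_mul_h : ddt P.g = P.g * P.h
  ddt_g_eq_m_mul_g : ddt P.g = P.m * P.g

end FiveTuple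

/-! ### Noncommutative symmetric functions -/

/-- `NSym`, the free associative algebra on `Λ_1, Λ_2, …`. -/
abbrev NSym (K : Type*) [CommRing K] : Type _ := FreeAlgebra K ℕ+

namespace NSym

section Families

variable (K : Type*) [CommRing K]

/-- The elementary functions: `Λ_0 = 1`, and `Λ_m` is the `m`-th generator for `m ≥ 1`. -/
def Lam (m : ℕ) : NSym K := if h : 0 < m then FreeAlgebra.ι K (m.toPNat h) else 1

/-- `λ(t) = ∑ t^m Λ_m`. -/
def lam : PowerSeries (NSym K) := PowerSeries.mk (Lam K)

/-- `σ(t) = λ(-t)⁻¹`. -/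
def sigma : PowerSeries (NSym K) := PowerSeries.invOfUnit (negT (lam K)) 1

/-- `ψ(t) = σ(t)⁻¹ σ'(t)`. -/
def psi : PowerSeries (NSym K) := negT (lam K) * ddt (sigma K)

/-- `ξ(t) = σ'(t) σ(t)⁻¹`. -/
def xi : PowerSeries (NSym K) := ddt (sigma K) * negT (lam K)

/-- The complete homogeneous function `S_m`: `σ(t) = ∑ t^m S_m`. -/
def Sm (m : ℕ) : NSym K := PowerSeries.coeff m (sigma K)

/-- The power sum `Ψ_m` of the first kind: `ψ(t) = ∑ t^(m-1) Ψ_m`. -/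
def Psi (m : ℕ+) : NSym K := PowerSeries.coeff m.natPred (psi K)

/-- The power sum `Ξ_m` of the third kind: `ξ(t) = ∑ t^(m-1) Ξ_m`. -/
def Xi (m : ℕ+) : NSym K := PowerSeries.coeff m.natPred (xi K)

variable [Algebra ℚ K]

/-- `Φ(t) = log σ(t)`. -/
def phi : PowerSeries (NSym K) := logT K (sigma K)

/-- The tuple `Π`: the NCS system over `NSym` whose first component is `λ(t)`. -/
def Pi : FiveTuple (NSym K) where
  f := lam K
  g := sigma K
  d := phi K
  h := psi K
  m := xi K

/-- The power sum `Φ_m` of the second kind: `Φ(t) = ∑ t^m Φ_m / m`. -/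
def Phi (m : ℕ+) : NSym K := (m : ℕ) • PowerSeries.coeff (m : ℕ) (phi K)

end Families

section Facts

variable {K : Type*} [CommRing K]

theorem constantCoeff_negT_lam : PowerSeries.constantCoeff (negT (lam K)) = 1 := by
  rw [← PowerSeries.coeff_zero_eq_constantCoeff_apply, negT, PowerSeries.coeff_mk, lam,
    PowerSeries.coeff_mk]
  simp [Lam]

theorem negT_lam_mul_sigma : negT (lam K) * sigma K = 1 :=
  PowerSeries.mul_invOfUnit _ _ constantCoeff_negT_lam

theorem sigma_mul_negT_lam : sigma K * negT (lam K) = 1 :=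
  PowerSeries.invOfUnit_mul _ _ constantCoeff_negT_lam

theorem constantCoeff_sigma : PowerSeries.constantCoeff (sigma K) = 1 := by
  simp [sigma]

theorem isNCS_Pi [Algebra ℚ K] : (Pi K).IsNCS K where
  f_zero := by
    simp [Pi, ← PowerSeries.coeff_zero_eq_constantCoeff_apply, lam, Lam]
  neg_f_mul_g := negT_lam_mul_sigma
  g_mul_neg_f := sigma_mul_negT_lam
  d_zero := constantCoeff_logT _
  exp_d := expT_logT constantCoeff_sigma
  ddt_g_eq_g_mul_h := by
    simp only [Pi, psi]
    rw [← mul_assoc, sigma_mul_negT_lam, one_mul]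
  ddt_g_eq_m_mul_g := by
    simp only [Pi, xi]
    rw [mul_assoc, negT_lam_mul_sigma, mul_one]

end Facts

end NSym

/-! ### Antipodes given on generators -/

section AntipodeAux

variable {K A : Type*} [CommRing K] [Ring A] [Bialgebra K A]

/-- `x ⊗ y ↦ S(x) y`. -/
def antipodeMulLeft (S : A →ₐ[K] Aᵐᵒᵖ) : A ⊗[K] A →ₗ[K] A :=
  LinearMap.mul' K A ∘ₗ TensorProduct.map
    ((MulOpposite.opLinearEquiv K).symm.toLinearMap ∘ₗ S.toLinearMap) LinearMap.id

/-- `x ⊗ y ↦ x S(y)`. -/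
def antipodeMulRight (S : A →ₐ[K] Aᵐᵒᵖ) : A ⊗[K] A →ₗ[K] A :=
  LinearMap.mul' K A ∘ₗ TensorProduct.map LinearMap.id
    ((MulOpposite.opLinearEquiv K).symm.toLinearMap ∘ₗ S.toLinearMap)

theorem antipodeMulLeft_mul (S : A →ₐ[K] Aᵐᵒᵖ) (x y : A ⊗[K] A) (c : K)
    (hx : antipodeMulLeft S x = algebraMap K A c) : antipodeMulLeft S (x * y) = c • antipodeMulLeft S y := by
  have key : ∀ a b : A, antipodeMulLeft S (x * a ⊗ₜ b) = c • antipodeMulLeft S (a ⊗ₜ b) := by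
    intro a b
    have h : ∀ z : A ⊗[K] A, antipodeMulLeft S (z * a ⊗ₜ b) = (S a).unop * antipodeMulLeft S z * b := by
      intro z
      induction z with
      | zero => simp
      | add z w hz hw => rw [add_mul, map_add, hz, hw, map_add, mul_add, add_mul]
      | tmul z w => simp [antipodeMulLeft, mul_assoc]
    rw [h, hx]
    simp [antipodeMulLeft, Algebra.algebraMap_eq_smul_one]
  induction y with
  | zero => simp
  | add z w hz hw => rw [mul_add, map_add, hz, hw, map_add, smul_add]
  | tmul z w => exact key z w

theorem antipodeMulRight_mul (S : A →ₐ[K] Aᵐᵒᵖ) (x y : A ⊗[K] A) (c : K)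
    (hy : antipodeMulRight S y = algebraMap K A c) : antipodeMulRight S (x * y) = c • antipodeMulRight S x := by
  have key : ∀ a b : A, antipodeMulRight S (a ⊗ₜ b * y) = c • antipodeMulRight S (a ⊗ₜ b) := by
    intro a b
    have h : ∀ z : A ⊗[K] A, antipodeMulRight S (a ⊗ₜ b * z) = a * antipodeMulRight S z * (S b).unop := by
      intro z
      induction z with
      | zero => simp
      | add z w hz hw => rw [mul_add, map_add, hz, hw, map_add, mul_add, add_mul]
      | tmul z w => simp [antipodeMulRight, mul_assoc]
    rw [h, hy]
    simp [antipodeMulRight, Algebra.algebraMap_eq_smul_one]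
  induction x with
  | zero => simp
  | add z w hz hw => rw [add_mul, map_add, hz, hw, map_add, smul_add]
  | tmul z w => exact key z w

/-- A bialgebra generated by a set `s` is a Hopf algebra as soon as an antihomomorphism `S`
satisfies the antipode identities on `s`. -/
abbrev hopfOfGenerators (S : A →ₐ[K] Aᵐᵒᵖ) (s : Set A) (hs : Algebra.adjoin K s = ⊤)
    (hl : ∀ a ∈ s, LinearMap.mul' K A (TensorProduct.map
      ((MulOpposite.opLinearEquiv K).symm.toLinearMap ∘ₗ S.toLinearMap) LinearMap.id
        (Coalgebra.comul (R := K) a)) = algebraMap K A (Coalgebra.counit (R := K) a))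
    (hr : ∀ a ∈ s, LinearMap.mul' K A (TensorProduct.map LinearMap.id
      ((MulOpposite.opLinearEquiv K).symm.toLinearMap ∘ₗ S.toLinearMap)
        (Coalgebra.comul (R := K) a)) = algebraMap K A (Coalgebra.counit (R := K) a)) :
    HopfAlgebra K A where
  antipode := (MulOpposite.opLinearEquiv K).symm.toLinearMap ∘ₗ S.toLinearMap
  mul_antipode_rTensor_comul := by
    ext a
    change antipodeMulLeft S (Coalgebra.comul (R := K) a) = algebraMap K A (Coalgebra.counit (R := K) a)
    have ha : a ∈ Algebra.adjoin K s := by rw [hs]; trivial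
    induction ha using Algebra.adjoin_induction with
    | mem x hx => exact hl x hx
    | algebraMap r => simp [antipodeMulLeft, Algebra.TensorProduct.one_def,
        Algebra.algebraMap_eq_smul_one]
    | add x y _ _ hx hy => simp only [map_add, hx, hy]
    | mul x y _ _ hx hy =>
      rw [Bialgebra.comul_mul, antipodeMulLeft_mul S _ _ _ hx, hy, Bialgebra.counit_mul, map_mul,
        Algebra.smul_def]
  mul_antipode_lTensor_comul := by
    ext a
    change antipodeMulRight S (Coalgebra.comul (R := K) a) = algebraMap K A (Coalgebra.counit (R := K) a)
    have ha : a ∈ Algebra.adjoin K s := by rw [hs]; trivial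
    induction ha using Algebra.adjoin_induction with
    | mem x hx => exact hr x hx
    | algebraMap r => simp [antipodeMulRight, Algebra.TensorProduct.one_def,
        Algebra.algebraMap_eq_smul_one]
    | add x y _ _ hx hy => simp only [map_add, hx, hy]
    | mul x y _ _ hx hy =>
      rw [Bialgebra.comul_mul, antipodeMulRight_mul S _ _ _ hy, hx, Bialgebra.counit_mul, map_mul,
        Algebra.smul_def, Algebra.commutes]

end AntipodeAux

/-! ### The Hopf algebra `NSym` -/

namespace NSym

section Hopf

variable {K : Type*} [CommRing K]

theorem Lam_zero : Lam K 0 = 1 := by simp [Lam]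

theorem Lam_pos (m : ℕ+) : Lam K m = FreeAlgebra.ι K m := by
  rw [Lam, dif_pos m.pos]
  exact congrArg _ (PNat.eq rfl)

/-- The coproduct: `Λ_m ↦ ∑ Λ_i ⊗ Λ_j` over `i + j = m`. -/
def comulHom : NSym K →ₐ[K] NSym K ⊗[K] NSym K :=
  FreeAlgebra.lift K fun m : ℕ+ =>
    ∑ p ∈ Finset.HasAntidiagonal.antidiagonal (m : ℕ), Lam K p.1 ⊗ₜ[K] Lam K p.2

/-- The counit: `Λ_m ↦ 0` for `m ≥ 1`. -/
def counitHom : NSym K →ₐ[K] K := FreeAlgebra.lift K fun _ => 0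

theorem comulHom_Lam (m : ℕ) : comulHom (Lam K m) =
    ∑ p ∈ Finset.HasAntidiagonal.antidiagonal m, Lam K p.1 ⊗ₜ[K] Lam K p.2 := by
  rcases Nat.eq_zero_or_pos m with rfl | h
  · simp [Lam_zero, Algebra.TensorProduct.one_def]
  · obtain ⟨m, rfl⟩ : ∃ m' : ℕ+, (m' : ℕ) = m := ⟨m.toPNat h, rfl⟩
    rw [Lam_pos, comulHom, FreeAlgebra.lift_ι_apply]

theorem counitHom_Lam (m : ℕ) : counitHom (Lam K m) = if m = 0 then 1 else 0 := by
  rcases Nat.eq_zero_or_pos m with rfl | h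
  · simp [Lam_zero]
  · obtain ⟨m, rfl⟩ : ∃ m' : ℕ+, (m' : ℕ) = m := ⟨m.toPNat h, rfl⟩
    rw [Lam_pos, counitHom, FreeAlgebra.lift_ι_apply, if_neg h.ne']

instance : Bialgebra K (NSym K) :=
  Bialgebra.ofAlgHom comulHom counitHom
    (by
      ext m
      simp only [Function.comp_apply, AlgHom.coe_comp, ← Lam_pos, comulHom_Lam, map_sum,
        Algebra.TensorProduct.map_tmul, AlgHom.id_apply, TensorProduct.sum_tmul,
        TensorProduct.tmul_sum]
      rw [Finset.sum_sigma', Finset.sum_sigma']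
      refine Finset.sum_nbij' (fun x => ⟨(x.2.1, x.2.2 + x.1.2), (x.2.2, x.1.2)⟩)
        (fun x => ⟨(x.1.1 + x.2.1, x.2.2), (x.1.1, x.2.1)⟩) ?_ ?_ ?_ ?_ ?_
      · rintro ⟨⟨i, j⟩, ⟨k, l⟩⟩ h
        simp only [Finset.mem_sigma, Finset.HasAntidiagonal.mem_antidiagonal] at h ⊢
        obtain ⟨h1, h2⟩ := h
        exact ⟨by rw [← h1, ← h2, add_assoc], trivial⟩
      · rintro ⟨⟨i, j⟩, ⟨k, l⟩⟩ h
        simp only [Finset.mem_sigma, Finset.HasAntidiagonal.mem_antidiagonal] at h ⊢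
        obtain ⟨h1, h2⟩ := h
        exact ⟨by rw [← h1, ← h2, add_assoc], trivial⟩
      · rintro ⟨⟨i, j⟩, ⟨k, l⟩⟩ h
        simp only [Finset.mem_sigma, Finset.HasAntidiagonal.mem_antidiagonal] at h
        obtain ⟨h1, rfl⟩ := h
        rfl
      · rintro ⟨⟨i, j⟩, ⟨k, l⟩⟩ h
        simp only [Finset.mem_sigma, Finset.HasAntidiagonal.mem_antidiagonal] at h
        obtain ⟨h1, rfl⟩ := h
        rfl
      · rintro ⟨⟨i, j⟩, ⟨k, l⟩⟩ h
        rfl)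
    (by
      ext m
      simp only [Function.comp_apply, AlgHom.coe_comp, ← Lam_pos, comulHom_Lam, map_sum,
        Algebra.TensorProduct.map_tmul, AlgHom.id_apply, counitHom_Lam]
      rw [Finset.sum_eq_single (0, (m : ℕ))]
      · simp
      · rintro ⟨i, j⟩ h hne
        have : i ≠ 0 := by
          rintro rfl
          exact hne (by simpa using h)
        simp [this]
      · intro h
        exact absurd (by simp) h)
    (by
      ext m
      simp only [Function.comp_apply, AlgHom.coe_comp, ← Lam_pos, comulHom_Lam, map_sum,
        Algebra.TensorProduct.map_tmul, AlgHom.id_apply, counitHom_Lam]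
      rw [Finset.sum_eq_single ((m : ℕ), 0)]
      · simp
      · rintro ⟨i, j⟩ h hne
        have : j ≠ 0 := by
          rintro rfl
          exact hne (by simpa using h)
        simp [this]
      · intro h
        exact absurd (by simp) h)

theorem comul_Lam (m : ℕ) : Coalgebra.comul (R := K) (Lam K m) =
    ∑ p ∈ Finset.HasAntidiagonal.antidiagonal m, Lam K p.1 ⊗ₜ[K] Lam K p.2 :=
  comulHom_Lam m

theorem counit_Lam (m : ℕ) : Coalgebra.counit (R := K) (Lam K m) = if m = 0 then 1 else 0 :=
  counitHom_Lam m

theorem Sm_zero : Sm K 0 = 1 := by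
  rw [Sm, PowerSeries.coeff_zero_eq_constantCoeff_apply, constantCoeff_sigma]

/-- The antipode, as an algebra homomorphism to the opposite algebra: `Λ_m ↦ (-1)^m S_m`. -/
def antipodeHom : NSym K →ₐ[K] (NSym K)ᵐᵒᵖ :=
  FreeAlgebra.lift K fun m : ℕ+ => MulOpposite.op ((-1) ^ (m : ℕ) * Sm K m)

theorem antipodeHom_Lam (m : ℕ) :
    antipodeHom (Lam K m) = MulOpposite.op ((-1) ^ m * Sm K m) := by
  rcases Nat.eq_zero_or_pos m with rfl | h
  · simp [Lam_zero, Sm_zero]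
  · obtain ⟨m, rfl⟩ : ∃ m' : ℕ+, (m' : ℕ) = m := ⟨m.toPNat h, rfl⟩
    rw [Lam_pos, antipodeHom, FreeAlgebra.lift_ι_apply]

theorem sum_Sm_mul_Lam (m : ℕ) : ∑ p ∈ Finset.HasAntidiagonal.antidiagonal m,
    (-1) ^ p.1 * Sm K p.1 * Lam K p.2 = if m = 0 then 1 else 0 := by
  have h := congrArg (fun x => (-1) ^ m * PowerSeries.coeff m x) (sigma_mul_negT_lam (K := K))
  simp only [PowerSeries.coeff_mul, PowerSeries.coeff_one, Finset.mul_sum] at h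
  refine (Finset.sum_congr rfl ?_).trans (h.trans ?_)
  · rintro ⟨i, j⟩ hij
    rw [Finset.HasAntidiagonal.mem_antidiagonal] at hij
    simp only [Sm, negT, lam, PowerSeries.coeff_mk] at hij ⊢
    subst hij
    rcases neg_one_pow_eq_or (NSym K) i with hi | hi <;>
      rcases neg_one_pow_eq_or (NSym K) j with hj | hj <;> simp [pow_add, hi, hj]
  · split_ifs with h0
    · simp [h0]
    · simp

theorem sum_Lam_mul_Sm (m : ℕ) : ∑ p ∈ Finset.HasAntidiagonal.antidiagonal m,
    Lam K p.1 * ((-1) ^ p.2 * Sm K p.2) = if m = 0 then 1 else 0 := by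
  have h := congrArg (fun x => (-1) ^ m * PowerSeries.coeff m x) (negT_lam_mul_sigma (K := K))
  simp only [PowerSeries.coeff_mul, PowerSeries.coeff_one, Finset.mul_sum] at h
  refine (Finset.sum_congr rfl ?_).trans (h.trans ?_)
  · rintro ⟨i, j⟩ hij
    rw [Finset.HasAntidiagonal.mem_antidiagonal] at hij
    simp only [Sm, negT, lam, PowerSeries.coeff_mk] at hij ⊢
    subst hij
    rcases neg_one_pow_eq_or (NSym K) i with hi | hi <;>
      rcases neg_one_pow_eq_or (NSym K) j with hj | hj <;> simp [pow_add, hi, hj]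
  · split_ifs with h0
    · simp [h0]
    · simp

instance : HopfAlgebra K (NSym K) :=
  hopfOfGenerators antipodeHom (Set.range (FreeAlgebra.ι K)) (FreeAlgebra.adjoin_range_ι K ℕ+)
    (by
      rintro _ ⟨m, rfl⟩
      rw [← Lam_pos, comul_Lam, counit_Lam, map_sum, map_sum]
      refine (Finset.sum_congr rfl ?_).trans ((sum_Sm_mul_Lam (K := K) m).trans ?_)
      · rintro ⟨i, j⟩ -
        simp [antipodeHom_Lam]
      · simp)
    (by
      rintro _ ⟨m, rfl⟩
      rw [← Lam_pos, comul_Lam, counit_Lam, map_sum, map_sum]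
      refine (Finset.sum_congr rfl ?_).trans ((sum_Lam_mul_Sm (K := K) m).trans ?_)
      · rintro ⟨i, j⟩ -
        simp [antipodeHom_Lam]
      · simp)

end Hopf

section Primitive

variable {K : Type*} [CommRing K]

theorem map_negT {A B : Type*} [Ring A] [Ring B] (φ : A →+* B) (f : PowerSeries A) :
    PowerSeries.map φ (negT f) = negT (PowerSeries.map φ f) := by
  ext m; simp [negT]

theorem map_ddt {A B : Type*} [Ring A] [Ring B] (φ : A →+* B) (f : PowerSeries A) :
    PowerSeries.map φ (ddt f) = ddt (PowerSeries.map φ f) := by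
  ext m; simp [ddt]

theorem negT_mul {A : Type*} [Ring A] (f g : PowerSeries A) :
    negT (f * g) = negT f * negT g := by
  ext m
  simp only [negT, PowerSeries.coeff_mul, PowerSeries.coeff_mk, Finset.mul_sum]
  refine Finset.sum_congr rfl ?_
  rintro ⟨i, j⟩ hij
  rw [Finset.HasAntidiagonal.mem_antidiagonal] at hij
  simp only at hij ⊢
  subst hij
  rcases neg_one_pow_eq_or A i with hi | hi <;>
    rcases neg_one_pow_eq_or A j with hj | hj <;> simp [pow_add, hi, hj]

theorem ddt_mul {A : Type*} [Ring A] (f g : PowerSeries A) :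
    ddt (f * g) = ddt f * g + f * ddt g := by
  ext m
  have e1 : PowerSeries.coeff m (ddt f * g) = ∑ p ∈ Finset.HasAntidiagonal.antidiagonal (m + 1),
      (p.1 : A) * (PowerSeries.coeff p.1 f * PowerSeries.coeff p.2 g) := by
    rw [Finset.Nat.sum_antidiagonal_succ, PowerSeries.coeff_mul]
    simp [ddt, mul_assoc]
  have e2 : PowerSeries.coeff m (f * ddt g) = ∑ p ∈ Finset.HasAntidiagonal.antidiagonal (m + 1),
      (p.2 : A) * (PowerSeries.coeff p.1 f * PowerSeries.coeff p.2 g) := by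
    rw [Finset.Nat.sum_antidiagonal_succ', PowerSeries.coeff_mul]
    simp only [ddt, PowerSeries.coeff_mk, Nat.cast_add, Nat.cast_one, Nat.cast_zero, zero_mul,
      zero_add]
    refine Finset.sum_congr rfl fun p _ => ?_
    rw [← mul_assoc, ← mul_assoc]
    congr 1
    exact ((Nat.cast_commute p.2 _).add_left (Commute.one_left _)).symm
  rw [map_add, e1, e2, ← Finset.sum_add_distrib, ddt, PowerSeries.coeff_mk, PowerSeries.coeff_mul,
    Finset.mul_sum]
  refine Finset.sum_congr rfl ?_
  rintro ⟨i, j⟩ hij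
  rw [Finset.HasAntidiagonal.mem_antidiagonal] at hij
  rw [← add_mul]
  congr 1
  exact_mod_cast congrArg (Nat.cast (R := A)) hij.symm

/-- The power sums `Ψ_m` are primitive. -/
theorem comul_Psi (m : ℕ+) :
    Coalgebra.comul (R := K) (Psi K m) = 1 ⊗ₜ[K] Psi K m + Psi K m ⊗ₜ[K] 1 := by
  set Δ : NSym K →+* NSym K ⊗[K] NSym K := (comulHom (K := K)).toRingHom
  set i₁ : NSym K →+* NSym K ⊗[K] NSym K :=
    (Algebra.TensorProduct.includeLeft (R := K) (S := K)).toRingHom with hi₁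
  set i₂ : NSym K →+* NSym K ⊗[K] NSym K :=
    (Algebra.TensorProduct.includeRight (R := K)).toRingHom with hi₂
  have hcomm : ∀ f g : PowerSeries (NSym K),
      PowerSeries.map i₁ f * PowerSeries.map i₂ g = PowerSeries.map i₂ g * PowerSeries.map i₁ f := by
    intro f g
    ext m
    rw [PowerSeries.coeff_mul, PowerSeries.coeff_mul, ← Finset.Nat.sum_antidiagonal_swap]
    refine Finset.sum_congr rfl fun p _ => ?_
    simp [hi₁, hi₂]
  have hlam : PowerSeries.map Δ (lam K) = PowerSeries.map i₁ (lam K) * PowerSeries.map i₂ (lam K) := by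
    ext m
    rw [PowerSeries.coeff_mul, PowerSeries.coeff_map, lam, PowerSeries.coeff_mk]
    refine (comulHom_Lam m).trans (Finset.sum_congr rfl fun p _ => ?_)
    simp [hi₁, hi₂]
  set L := negT (lam K)
  have hL : PowerSeries.map Δ L = PowerSeries.map i₁ L * PowerSeries.map i₂ L := by
    rw [map_negT, hlam, negT_mul, map_negT, map_negT]
  have hLs : L * sigma K = 1 := negT_lam_mul_sigma
  have hsL : sigma K * L = 1 := sigma_mul_negT_lam
  have hLs₁ : PowerSeries.map i₁ L * PowerSeries.map i₁ (sigma K) = 1 := by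
    rw [← map_mul, hLs, map_one]
  have hLs₂ : PowerSeries.map i₂ L * PowerSeries.map i₂ (sigma K) = 1 := by
    rw [← map_mul, hLs, map_one]
  have hs : PowerSeries.map Δ (sigma K) =
      PowerSeries.map i₁ (sigma K) * PowerSeries.map i₂ (sigma K) := by
    have h1 : PowerSeries.map Δ (sigma K) * PowerSeries.map Δ L = 1 := by
      rw [← map_mul, hsL, map_one]
    have h2 : PowerSeries.map Δ L *
        (PowerSeries.map i₁ (sigma K) * PowerSeries.map i₂ (sigma K)) = 1 := by
      rw [hL, hcomm (sigma K), mul_assoc, ← mul_assoc (PowerSeries.map i₂ L), hLs₂, one_mul, hLs₁]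
    exact left_inv_eq_right_inv h1 h2
  have hpsi : PowerSeries.map Δ (psi K) =
      PowerSeries.map i₂ (psi K) + PowerSeries.map i₁ (psi K) := by
    rw [psi, map_mul, map_ddt, hs, ddt_mul, ← map_ddt, ← map_ddt, mul_add, add_comm]
    congr 1
    · rw [hL, hcomm L L, mul_assoc, ← mul_assoc (PowerSeries.map i₁ L), hLs₁, one_mul, ← map_mul]
    · rw [hL, mul_assoc, hcomm (ddt _), ← mul_assoc (PowerSeries.map i₂ L), hLs₂, one_mul,
        ← map_mul]
  have := congrArg (PowerSeries.coeff m.natPred) hpsi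
  rw [PowerSeries.coeff_map, map_add, PowerSeries.coeff_map, PowerSeries.coeff_map] at this
  exact this

end Primitive

end NSym

/-! ### The Hopf algebra structure of an enveloping algebra -/

namespace UniversalEnvelopingAlgebra

section Hopf

attribute [local instance 100] LieRing.ofAssociativeRing

variable (K : Type*) [CommRing K] (L : Type*) [LieRing L] [LieAlgebra K L]

/-- `δ ↦ 1 ⊗ δ + δ ⊗ 1`. -/
def comulLie : L →ₗ⁅K⁆ UniversalEnvelopingAlgebra K L ⊗[K] UniversalEnvelopingAlgebra K L where
  toFun x := 1 ⊗ₜ[K] ι K x + ι K x ⊗ₜ[K] 1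
  map_add' x y := by
    simp only [map_add, TensorProduct.tmul_add, TensorProduct.add_tmul]; abel
  map_smul' c x := by
    simp only [map_smul, TensorProduct.tmul_smul, TensorProduct.smul_tmul', smul_add,
      RingHom.id_apply]
  map_lie' {x y} := by
    simp only [LieHom.map_lie, LieRing.of_associative_ring_bracket, TensorProduct.tmul_sub,
      TensorProduct.sub_tmul, mul_add, add_mul, Algebra.TensorProduct.tmul_mul_tmul, one_mul,
      mul_one]
    abel

/-- `δ ↦ -δ`, with values in the opposite algebra. -/
def antipodeLie : L →ₗ⁅K⁆ (UniversalEnvelopingAlgebra K L)ᵐᵒᵖ where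
  toFun x := MulOpposite.op (-ι K x)
  map_add' x y := by
    rw [map_add, neg_add, MulOpposite.op_add]
  map_smul' c x := by
    rw [map_smul, ← smul_neg, MulOpposite.op_smul, RingHom.id_apply]
  map_lie' {x y} := by
    simp only [LieHom.map_lie, LieRing.of_associative_ring_bracket, ← MulOpposite.op_mul,
      ← MulOpposite.op_sub, neg_mul_neg, neg_sub]

theorem adjoin_range_ι :
    Algebra.adjoin K (Set.range (ι K : L → UniversalEnvelopingAlgebra K L)) = ⊤ := by
  set B := Algebra.adjoin K (Set.range (ι K : L → UniversalEnvelopingAlgebra K L)) with hB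
  let j : L →ₗ⁅K⁆ B :=
    { toFun := fun x => ⟨ι K x, Algebra.subset_adjoin ⟨x, rfl⟩⟩
      map_add' := fun x y => Subtype.ext (map_add _ _ _)
      map_smul' := fun c x => Subtype.ext (map_smul _ _ _)
      map_lie' := fun {x y} => Subtype.ext (LieHom.map_lie _ _ _) }
  have h : B.val.comp (lift K j) = AlgHom.id K _ := by
    apply hom_ext
    refine LieHom.ext fun x => ?_
    change ((lift K j (ι K x) : B) : UniversalEnvelopingAlgebra K L) = ι K x
    rw [lift_ι_apply]
    rfl
  rw [eq_top_iff]
  intro x _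
  have hx : ((lift K j x : B) : UniversalEnvelopingAlgebra K L) = x := DFunLike.congr_fun h x
  rw [← hx]
  exact (lift K j x).2

/-- The bialgebra structure for which the elements of the Lie algebra are primitive. -/
instance : Bialgebra K (UniversalEnvelopingAlgebra K L) :=
  Bialgebra.ofAlgHom (lift K (comulLie K L)) (lift K 0)
    (by
      refine AlgHom.ext_of_adjoin_eq_top (adjoin_range_ι K L) ?_
      rintro _ ⟨x, rfl⟩
      simp only [AlgHom.comp_apply, lift_ι_apply]
      simp [-ι_apply, comulLie, TensorProduct.add_tmul, TensorProduct.tmul_add, lift_ι_apply,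
        Algebra.TensorProduct.one_def]
      abel)
    (by
      refine AlgHom.ext_of_adjoin_eq_top (adjoin_range_ι K L) ?_
      rintro _ ⟨x, rfl⟩
      simp [-ι_apply, comulLie, lift_ι_apply])
    (by
      refine AlgHom.ext_of_adjoin_eq_top (adjoin_range_ι K L) ?_
      rintro _ ⟨x, rfl⟩
      simp [-ι_apply, comulLie, lift_ι_apply])

theorem comul_ι (x : L) :
    Coalgebra.comul (R := K) (ι K x) = 1 ⊗ₜ[K] ι K x + ι K x ⊗ₜ[K] 1 :=
  lift_ι_apply K (comulLie K L) x

theorem counit_ι (x : L) : Coalgebra.counit (R := K) (ι K x) = 0 :=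
  lift_ι_apply K (0 : L →ₗ⁅K⁆ K) x

/-- The antipode is the antihomomorphism with `S(δ) = -δ`. -/
instance : HopfAlgebra K (UniversalEnvelopingAlgebra K L) :=
  hopfOfGenerators (lift K (antipodeLie K L)) _ (adjoin_range_ι K L)
    (by
      rintro _ ⟨x, rfl⟩
      rw [comul_ι, counit_ι]
      have h : lift K (antipodeLie K L) (ι K x) = MulOpposite.op (-ι K x) := lift_ι_apply K _ x
      simp [-ι_apply, h])
    (by
      rintro _ ⟨x, rfl⟩
      rw [comul_ι, counit_ι]
      have h : lift K (antipodeLie K L) (ι K x) = MulOpposite.op (-ι K x) := lift_ι_apply K _ x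
      simp [-ι_apply, h])

theorem antipode_ι (x : L) : HopfAlgebra.antipode K (ι K x) = -ι K x := by
  have h : lift K (antipodeLie K L) (ι K x) = MulOpposite.op (-ι K x) := lift_ι_apply K _ x
  change (MulOpposite.opLinearEquiv K).symm (lift K (antipodeLie K L) (ι K x)) = _
  rw [h]; rfl

end Hopf

end UniversalEnvelopingAlgebra

/-! ### Differential operators -/

section DiffOp

attribute [local instance 100] LieRing.ofAssociativeRing

variable (k : VarKind) (n : ℕ) (K : Type*) [CommRing K] (α : ℕ)

/-- `𝒟er^[α]⟨⟨z⟩⟩`: the Lie algebra of `K`-derivations of `K⟨⟨z⟩⟩` which increase the degree in `z`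
by at least `α - 1`. -/
def DerLie : LieSubalgebra K (Module.End K (Zser k n K)) where
  carrier := {δ | (∀ f g, δ (f * g) = δ f * g + f * δ g) ∧
    ∀ m u, OrdGE m u → OrdGE (m + (α - 1)) (δ u)}
  zero_mem' := ⟨fun f g => by simp, fun m u _ w _ => rfl⟩
  add_mem' {a b} ha hb := by
    refine ⟨fun f g => ?_, fun m u hu w hw => ?_⟩
    · simp only [LinearMap.add_apply, ha.1, hb.1, add_mul, mul_add]; abel
    · simp [ha.2 m u hu w hw, hb.2 m u hu w hw]
  smul_mem' c a ha := by
    refine ⟨fun f g => ?_, fun m u hu w hw => ?_⟩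
    · simp only [LinearMap.smul_apply, ha.1, smul_add, smul_mul_assoc, mul_smul_comm]
    · simp [ha.2 m u hu w hw]
  lie_mem' {a b} ha hb := by
    have key : ∀ {a b : Module.End K (Zser k n K)},
        (∀ m u, OrdGE m u → OrdGE (m + (α - 1)) (a u)) →
        (∀ m u, OrdGE m u → OrdGE (m + (α - 1)) (b u)) →
        ∀ m u, OrdGE m u → OrdGE (m + (α - 1)) (a (b u)) := by
      intro a b ha hb m u hu w hw
      exact ha _ _ (hb m u hu) w (by omega)
    refine ⟨fun f g => ?_, fun m u hu w hw => ?_⟩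
    · simp only [LieRing.of_associative_ring_bracket, LinearMap.sub_apply, Module.End.mul_apply,
        ha.1, hb.1, map_add, sub_mul, mul_sub]
      abel
    · have h1 := key ha.2 hb.2 m u hu w hw
      have h2 := key hb.2 ha.2 m u hu w hw
      change a (b u) w - b (a u) w = 0
      rw [h1, h2, sub_zero]

/-- `𝒟^[α]⟨⟨z⟩⟩`: the unital algebra of operators on `K⟨⟨z⟩⟩` generated by `𝒟er^[α]⟨⟨z⟩⟩`. -/
def DiffOp : Subalgebra K (Module.End K (Zser k n K)) :=
  Algebra.adjoin K (DerLie k n K α : Set (Module.End K (Zser k n K)))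

/-- The inclusion of `𝒟er^[α]⟨⟨z⟩⟩` in `𝒟^[α]⟨⟨z⟩⟩`. -/
def derIncl : DerLie k n K α →ₗ⁅K⁆ DiffOp k n K α where
  toFun δ := ⟨δ, Algebra.subset_adjoin δ.2⟩
  map_add' _ _ := rfl
  map_smul' _ _ := rfl
  map_lie' := rfl

/-- The enveloping algebra of the Lie algebra `𝒟er^[α]⟨⟨z⟩⟩`. -/
abbrev EnvDer : Type _ := UniversalEnvelopingAlgebra K (DerLie k n K α)

/-- The canonical inclusion of `𝒟er^[α]⟨⟨z⟩⟩` in its enveloping algebra. -/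
def derEnv (δ : DerLie k n K α) : EnvDer k n K α := UniversalEnvelopingAlgebra.ι K δ

/-- The canonical homomorphism from the enveloping algebra onto `𝒟^[α]⟨⟨z⟩⟩`. -/
def envAction : EnvDer k n K α →ₐ[K] DiffOp k n K α :=
  UniversalEnvelopingAlgebra.lift K (derIncl k n K α)

theorem envAction_surjective : Function.Surjective (envAction k n K α) := by
  rintro ⟨D, hD⟩
  have h : DiffOp k n K α ≤ ((DiffOp k n K α).val.comp (envAction k n K α)).range := by
    refine Algebra.adjoin_le ?_
    intro δ hδ
    exact ⟨derEnv k n K α ⟨δ, hδ⟩, congrArg Subtype.val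
      (UniversalEnvelopingAlgebra.lift_ι_apply K (derIncl k n K α) ⟨δ, hδ⟩)⟩
  obtain ⟨x, hx⟩ := h hD
  exact ⟨x, Subtype.ext hx⟩

end DiffOp

/-! ### The automorphisms `F_t` and the tuple `Ω_{F_t}` -/

/-- `𝔸_t^[α]⟨⟨z⟩⟩`: the automorphisms `F_t` of `K[[t]]⟨⟨z⟩⟩` over `K[[t]]` of the form
`F_t(z) = z - H_t(z)` with `o(H_t(z)) ≥ α` and `H_{t=0}(z) = 0`; the automorphism is
`u_t(z) ↦ u_t(F_t)`. -/
structure AutT (k : VarKind) (n : ℕ) (K : Type*) [CommRing K] (α : ℕ) where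
  toAlgEquiv : Zsert k n K ≃ₐ[PowerSeries K] Zsert k n K
  ordGE : ∀ i, OrdGE α (zvar i - toAlgEquiv (zvar i))
  at_zero : ∀ i, coeffT 0 (zvar i - toAlgEquiv (zvar i)) = 0

namespace AutT

variable {k : VarKind} {n : ℕ} {K : Type*} [CommRing K] {α : ℕ}

/-- `F_t(z) = z - H_t(z)`. -/
def H (F : AutT k n K α) (i : Fin n) : Zsert k n K := zvar i - F.toAlgEquiv (zvar i)

/-- `G_t(z) = F_t⁻¹(z) = z + M_t(z)`. -/
def M (F : AutT k n K α) (i : Fin n) : Zsert k n K := F.toAlgEquiv.symm (zvar i) - zvar i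

end AutT

section Omega

variable {k : VarKind} {n : ℕ} {K : Type*} [CommRing K] [Algebra ℚ K] {α : ℕ}

/-- The series `∑ t^m φ_m / m`. -/
def dSeries (φ : ℕ+ → DerLie k n K α) : PowerSeries (DiffOp k n K α) :=
  PowerSeries.mk fun m =>
    if h : 0 < m then algebraMap ℚ K (1 / m) • derIncl k n K α (φ (m.toPNat h)) else 0

/-- The series `∑ t^(m-1) δ_m`. -/
def hSeries (δ : ℕ+ → DerLie k n K α) : PowerSeries (DiffOp k n K α) :=
  PowerSeries.mk fun m => derIncl k n K α (δ m.succPNat)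

/-- The five sequences of differential operators attached to `F_t`, with their defining equations.
A derivation is prescribed by its values on the variables: `[a ∂/∂z]` is the derivation `δ` with
`δ z_i = a_i`. -/
@[ext] structure Omega (F : AutT k n K α) where
  lam : ℕ → DiffOp k n K α
  s : ℕ → DiffOp k n K α
  /-- the D-Log `a_t(z)` of `F_t` -/
  dlog : Fin n → Zsert k n K
  phi : ℕ+ → DerLie k n K α
  psi : ℕ+ → DerLie k n K α
  xi : ℕ+ → DerLie k n K α
  lam_zero : lam 0 = 1
  s_zero : s 0 = 1
  /-- `(∑ (-1)^m t^m λ_m) u_t(z) = u_t(F_t)` -/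
  lam_apply : ∀ (u : Zsert k n K) (m : ℕ),
    ∑ p ∈ Finset.HasAntidiagonal.antidiagonal m,
      (-1 : K) ^ p.1 • (lam p.1 : Module.End K (Zser k n K)) (coeffT p.2 u) =
        coeffT m (F.toAlgEquiv u)
  /-- `(∑ t^m s_m) u_t(z) = u_t(G_t)` -/
  s_apply : ∀ (u : Zsert k n K) (m : ℕ),
    ∑ p ∈ Finset.HasAntidiagonal.antidiagonal m,
      (s p.1 : Module.End K (Zser k n K)) (coeffT p.2 u) = coeffT m (F.toAlgEquiv.symm u)
  dlog_zero : ∀ i, coeffT 0 (dlog i) = 0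
  dlog_ordGE : ∀ i, OrdGE α (dlog i)
  /-- `∑ t^m φ_m / m = -[a_t(z) ∂/∂z]` -/
  phi_apply : ∀ (m : ℕ+) (i : Fin n),
    algebraMap ℚ K (1 / (m : ℕ)) • (phi m : Module.End K (Zser k n K)) (zvar i) =
      -coeffT m (dlog i)
  /-- `exp [a_t(z) ∂/∂z] z = F_t(z)`; the exponent is `-∑ t^m φ_m / m` -/
  exp_dlog : ∀ (m : ℕ) (i : Fin n),
    ((PowerSeries.coeff m (expT K (-dSeries phi)) : DiffOp k n K α) :
      Module.End K (Zser k n K)) (zvar i) =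
      coeffT m (F.toAlgEquiv (zvar i))
  /-- `∑ t^(m-1) ψ_m = [(∂M_t/∂t)(F_t) ∂/∂z]` -/
  psi_apply : ∀ (m : ℕ) (i : Fin n), (psi m.succPNat : Module.End K (Zser k n K)) (zvar i) =
    coeffT m (F.toAlgEquiv (derivT (F.M i)))
  /-- `∑ t^(m-1) ξ_m = [(∂H_t/∂t)(G_t) ∂/∂z]` -/
  xi_apply : ∀ (m : ℕ) (i : Fin n), (xi m.succPNat : Module.End K (Zser k n K)) (zvar i) =
    coeffT m (F.toAlgEquiv.symm (derivT (F.H i)))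

/-- `Ω_{F_t} = (f(t), g(t), d(t), h(t), m(t))`. -/
def Omega.tuple {F : AutT k n K α} (Ω : Omega F) : FiveTuple (DiffOp k n K α) where
  f := PowerSeries.mk Ω.lam
  g := PowerSeries.mk Ω.s
  d := dSeries Ω.phi
  h := hSeries Ω.psi
  m := hSeries Ω.xi

end Omega

end

noncomputable section

section TSeriesLemmas

open Finset.HasAntidiagonal (antidiagonal mem_antidiagonal)

section

variable {A : Type*} [Ring A]

theorem coeff_ddt (f : PowerSeries A) (m : ℕ) :
    PowerSeries.coeff m (ddt f) = (m + 1) • PowerSeries.coeff (m + 1) f := by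
  rw [ddt, PowerSeries.coeff_mk, nsmul_eq_mul]
  push_cast
  rfl

theorem coeff_mul_eq_zero_of_lt {f g : PowerSeries A} {a b m : ℕ}
    (hf : ∀ i < a, PowerSeries.coeff i f = 0) (hg : ∀ i < b, PowerSeries.coeff i g = 0)
    (h : m < a + b) : PowerSeries.coeff m (f * g) = 0 := by
  rw [PowerSeries.coeff_mul]
  refine Finset.sum_eq_zero fun p hp => ?_
  have := mem_antidiagonal.1 hp
  rcases Nat.lt_or_ge p.1 a with h1 | h1
  · rw [hf _ h1, zero_mul]
  · rw [hg _ (by omega), mul_zero]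

theorem coeff_pow_congr {x y : PowerSeries A} {m : ℕ}
    (h : ∀ i < m, PowerSeries.coeff i x = PowerSeries.coeff i y) (j : ℕ) :
    ∀ i < m, PowerSeries.coeff i (x ^ j) = PowerSeries.coeff i (y ^ j) := by
  induction j with
  | zero => simp
  | succ j ih =>
    intro i hi
    rw [pow_succ, pow_succ, PowerSeries.coeff_mul, PowerSeries.coeff_mul]
    refine Finset.sum_congr rfl fun p hp => ?_
    have := mem_antidiagonal.1 hp
    rw [ih _ (by omega), h _ (by omega)]

theorem coeff_pow_add_two_congr {x y : PowerSeries A} (hx : PowerSeries.constantCoeff x = 0)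
    (hy : PowerSeries.constantCoeff y = 0) {m : ℕ}
    (h : ∀ i < m, PowerSeries.coeff i x = PowerSeries.coeff i y) (j : ℕ) :
    PowerSeries.coeff m (x ^ (j + 2)) = PowerSeries.coeff m (y ^ (j + 2)) := by
  rw [pow_succ, pow_succ y, PowerSeries.coeff_mul, PowerSeries.coeff_mul]
  refine Finset.sum_congr rfl fun p hp => ?_
  have := mem_antidiagonal.1 hp
  rcases Nat.eq_zero_or_pos p.1 with h1 | h1
  · rw [h1, coeff_pow_eq_zero hx (Nat.succ_pos j), coeff_pow_eq_zero hy (Nat.succ_pos j),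
      zero_mul, zero_mul]
  rcases Nat.eq_zero_or_pos p.2 with h2 | h2
  · rw [h2, PowerSeries.coeff_zero_eq_constantCoeff_apply, hx,
      PowerSeries.coeff_zero_eq_constantCoeff_apply, hy, mul_zero, mul_zero]
  rw [coeff_pow_congr h _ _ (by omega), h _ (by omega)]

theorem map_evalT {K A B : Type*} [CommRing K] [Ring A] [Algebra K A] [Ring B] [Algebra K B] (S : A →ₐ[K] B) (p : PowerSeries K)
    (x : PowerSeries A) :
    PowerSeries.map S.toRingHom (evalT p x) = evalT p (PowerSeries.map S.toRingHom x) := by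
  ext m
  rw [PowerSeries.coeff_map, coeff_evalT_def, coeff_evalT_def, map_sum]
  refine Finset.sum_congr rfl fun j _ => ?_
  rw [← map_pow, PowerSeries.coeff_map]
  exact map_smul S _ _

end

variable (K : Type*) {A : Type*} [CommRing K] [Algebra ℚ K] [Ring A] [Algebra K A]

theorem invNat_smul_nsmul {V : Type*} [AddCommGroup V] [Module K V] {m : ℕ} (hm : 0 < m) (a : V) :
    algebraMap ℚ K (1 / (m : ℚ)) • (m • a) = a := by
  rw [← Nat.cast_smul_eq_nsmul K, smul_smul]
  have : algebraMap ℚ K (1 / (m : ℚ)) * (m : K) = 1 := by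
    rw [← map_natCast (algebraMap ℚ K), ← map_mul, one_div_mul_cancel (by positivity), map_one]
  rw [this, one_smul]

theorem nsmul_left_cancel {V : Type*} [AddCommGroup V] [Module K V] {m : ℕ} (hm : 0 < m)
    {a b : V} (h : m • a = m • b) : a = b := by
  rw [← invNat_smul_nsmul K hm a, h, invNat_smul_nsmul K hm]

/-- A linear differential equation `f' = f p` has at most one solution with given initial value. -/
theorem eq_of_ddt_eq_mul (K : Type*) {A : Type*} [CommRing K] [Algebra ℚ K] [Ring A]
    [Algebra K A] {f g p : PowerSeries A} (hf : ddt f = f * p) (hg : ddt g = g * p)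
    (h0 : PowerSeries.constantCoeff f = PowerSeries.constantCoeff g) : f = g := by
  ext m
  induction m using Nat.strong_induction_on with
  | _ m ih =>
    rcases m with _ | m
    · simpa using h0
    · refine nsmul_left_cancel K (m := m + 1) (Nat.succ_pos m) ?_
      rw [← coeff_ddt, ← coeff_ddt, hf, hg, PowerSeries.coeff_mul, PowerSeries.coeff_mul]
      refine Finset.sum_congr rfl fun p hp => ?_
      rw [ih p.1 (by have := mem_antidiagonal.1 hp; omega)]

theorem expT_add {x y : PowerSeries A} (hx : PowerSeries.constantCoeff x = 0)
    (hy : PowerSeries.constantCoeff y = 0) (hxy : Commute x y) :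
    expT K (x + y) = expT K x * expT K y := by
  ext m
  rw [PowerSeries.coeff_mul]
  have h1 : ∀ a ∈ antidiagonal m,
      PowerSeries.coeff a.1 (expT K x) * PowerSeries.coeff a.2 (expT K y) =
      ∑ i ∈ Finset.range (m + 1), ∑ j ∈ Finset.range (m + 1),
        (PowerSeries.coeff i (PowerSeries.exp K) * PowerSeries.coeff j (PowerSeries.exp K)) •
          (PowerSeries.coeff a.1 (x ^ i) * PowerSeries.coeff a.2 (y ^ j)) := by
    intro a ha
    have ha' := mem_antidiagonal.1 ha
    rw [expT, expT, coeff_evalT _ hx (N := m + 1) (by omega),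
      coeff_evalT _ hy (N := m + 1) (by omega), Finset.sum_mul_sum]
    refine Finset.sum_congr rfl fun i _ => Finset.sum_congr rfl fun j _ => ?_
    rw [smul_mul_smul_comm]
  rw [Finset.sum_congr rfl h1, Finset.sum_comm]
  simp_rw [Finset.sum_comm (s := antidiagonal m)]
  simp_rw [← Finset.smul_sum, ← PowerSeries.coeff_mul]
  rw [expT, evalT, PowerSeries.coeff_mk]
  have h2 : ∀ j ∈ Finset.range (m + 1),
      PowerSeries.coeff j (PowerSeries.exp K) • PowerSeries.coeff m ((x + y) ^ j) =
      ∑ p ∈ antidiagonal j,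
        (PowerSeries.coeff p.1 (PowerSeries.exp K) * PowerSeries.coeff p.2 (PowerSeries.exp K)) •
          PowerSeries.coeff m (x ^ p.1 * y ^ p.2) := by
    intro j _
    rw [hxy.add_pow', map_sum, Finset.smul_sum]
    refine Finset.sum_congr rfl fun p hp => ?_
    obtain rfl := mem_antidiagonal.1 hp
    rw [map_nsmul, ← Nat.cast_smul_eq_nsmul K, smul_smul]
    congr 1
    simp only [PowerSeries.coeff_exp]
    rw [← map_natCast (algebraMap ℚ K), ← map_mul, ← map_mul, Nat.choose_symm_add, Nat.add_choose,
      Nat.cast_div (Nat.factorial_mul_factorial_dvd_factorial_add _ _) (by positivity)]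
    congr 1
    push_cast
    field_simp
  rw [Finset.sum_congr rfl h2, ← Finset.sum_product', Finset.sum_sigma']
  refine Finset.sum_of_injOn (fun y => y.2) ?_ ?_ ?_ ?_
  · rintro ⟨j, a, b⟩ h ⟨j', a', b'⟩ h' hh
    simp only [Finset.coe_sigma, Set.mem_sigma_iff, Finset.mem_coe, mem_antidiagonal] at h h' hh
    obtain ⟨rfl, rfl⟩ := Prod.mk.inj hh
    obtain ⟨-, rfl⟩ := h
    obtain ⟨-, rfl⟩ := h'
    rfl
  · rintro ⟨j, a, b⟩ h
    simp only [Finset.coe_sigma, Set.mem_sigma_iff, Finset.mem_coe, Finset.mem_range,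
      mem_antidiagonal, Finset.coe_product, Set.mem_prod] at h ⊢
    omega
  · rintro ⟨a, b⟩ h hh
    rw [coeff_mul_eq_zero_of_lt (fun i hi => coeff_pow_eq_zero hx hi)
      (fun i hi => coeff_pow_eq_zero hy hi), smul_zero]
    by_contra hlt
    refine hh ⟨⟨a + b, a, b⟩, ?_, rfl⟩
    simp only [Finset.coe_sigma, Set.mem_sigma_iff, Finset.mem_coe, Finset.mem_range,
      mem_antidiagonal]
    exact ⟨by omega, trivial⟩
  · rintro ⟨j, a, b⟩ _
    rfl

theorem expT_zero : expT K (0 : PowerSeries A) = 1 := by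
  ext m
  rw [expT, coeff_evalT_def, Finset.sum_eq_single 0]
  · simp
  · intro j _ hj
    simp [hj]
  · simp

theorem expT_neg_mul_expT {x : PowerSeries A} (hx : PowerSeries.constantCoeff x = 0) :
    expT K (-x) * expT K x = 1 := by
  rw [← expT_add K (by simp [hx]) hx (Commute.refl x).neg_left, neg_add_cancel, expT_zero]

theorem coeff_expT_sub_coeff_expT {x y : PowerSeries A} (hx : PowerSeries.constantCoeff x = 0)
    (hy : PowerSeries.constantCoeff y = 0) {m : ℕ}
    (h : ∀ i < m, PowerSeries.coeff i x = PowerSeries.coeff i y) :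
    PowerSeries.coeff m (expT K x) - PowerSeries.coeff m (expT K y) =
      PowerSeries.coeff m x - PowerSeries.coeff m y := by
  rw [expT, expT, coeff_evalT _ hx (N := m + 2) (by omega),
    coeff_evalT _ hy (N := m + 2) (by omega), ← Finset.sum_sub_distrib,
    Finset.sum_eq_single 1]
  · simp
  · rintro j - hj
    rcases j with _ | _ | j
    · simp
    · exact absurd rfl hj
    · rw [coeff_pow_add_two_congr hx hy h, sub_self]
  · intro h1
    exact absurd (Finset.mem_range.2 (by omega)) h1

theorem expT_injective {x y : PowerSeries A} (hx : PowerSeries.constantCoeff x = 0)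
    (hy : PowerSeries.constantCoeff y = 0) (h : expT K x = expT K y) : x = y := by
  ext m
  induction m using Nat.strong_induction_on with
  | _ m ih =>
    have := coeff_expT_sub_coeff_expT K hx hy ih
    rw [h, sub_self] at this
    exact (sub_eq_zero.1 this.symm)

theorem map_expT {B : Type*} [Ring B] [Algebra K B] (S : A →ₐ[K] B) (x : PowerSeries A) :
    PowerSeries.map S.toRingHom (expT K x) = expT K (PowerSeries.map S.toRingHom x) :=
  map_evalT S _ x

end TSeriesLemmas

end

noncomputable section

section Powers

variable {K A : Type*} [CommRing K] [Ring A] [Algebra K A]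

/-- The values of a polynomial with coefficients in a module at the natural numbers determine its
coefficients, by linear combinations with rational coefficients. -/
theorem coeff_mem_of_forall_sum_mem [Algebra ℚ K] {V : Type*} [AddCommGroup V] [Module K V]
    (N : Submodule K V) (d : ℕ) (c : ℕ → V)
    (h : ∀ s : ℕ, ∑ i ∈ Finset.range d, s ^ i • c i ∈ N) {i : ℕ} (hi : i < d) : c i ∈ N := by
  let V₀ : Matrix (Fin d) (Fin d) ℚ := Matrix.vandermonde fun s => ((s : ℕ) : ℚ)
  have hdet : IsUnit V₀.det := by
    refine isUnit_iff_ne_zero.2 (Matrix.det_vandermonde_ne_zero_iff.2 ?_)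
    intro a b hab
    exact Fin.ext (Nat.cast_injective hab)
  have hW : V₀⁻¹ * V₀ = 1 := Matrix.nonsing_inv_mul _ hdet
  have hV : ∀ s j : Fin d, algebraMap ℚ K (V₀ s j) = (((s : ℕ) ^ (j : ℕ) : ℕ) : K) := by
    intro s j
    simp [V₀, Matrix.vandermonde_apply]
  have key : ∑ s : Fin d, algebraMap ℚ K (V₀⁻¹ ⟨i, hi⟩ s) •
      ∑ j ∈ Finset.range d, (s : ℕ) ^ j • c j = c i := by
    simp_rw [← Fin.sum_univ_eq_sum_range (fun j => _ ^ j • c j) d, Finset.smul_sum]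
    rw [Finset.sum_comm, Finset.sum_eq_single ⟨i, hi⟩]
    · have e := congrFun (congrFun hW ⟨i, hi⟩) ⟨i, hi⟩
      rw [Matrix.mul_apply, Matrix.one_apply_eq] at e
      have e' := congrArg (fun r => algebraMap ℚ K r • c i) e
      simp only [map_sum, map_mul, map_one, one_smul, Finset.sum_smul] at e'
      refine (Finset.sum_congr rfl fun s _ => ?_).trans e'
      rw [hV, mul_smul, Nat.cast_smul_eq_nsmul]
    · intro j _ hj
      have e := congrFun (congrFun hW ⟨i, hi⟩) j
      rw [Matrix.mul_apply, Matrix.one_apply_ne hj.symm] at e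
      have e' := congrArg (fun r => algebraMap ℚ K r • c j) e
      simp only [map_sum, map_mul, map_zero, zero_smul, Finset.sum_smul] at e'
      refine (Finset.sum_congr rfl fun s _ => ?_).trans e'
      rw [hV, mul_smul, Nat.cast_smul_eq_nsmul]
    · simp
  rw [← key]
  exact N.sum_mem fun s _ => N.smul_mem _ (h s)

/-- The span of the powers `a ^ j`, `a ∈ L`, `j ≤ n`. -/
def powSpan (L : Submodule K A) (n : ℕ) : Submodule K A :=
  Submodule.span K {x | ∃ a ∈ L, ∃ j ≤ n, a ^ j = x}

theorem powSpan_mono (L : Submodule K A) {m n : ℕ} (h : m ≤ n) : powSpan L m ≤ powSpan L n := by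
  refine Submodule.span_mono ?_
  rintro _ ⟨a, ha, j, hj, rfl⟩
  exact ⟨a, ha, j, hj.trans h, rfl⟩

variable {L : Submodule K A}

theorem pow_mem_one_sup_pow {a : A} (ha : a ∈ L) (n : ℕ) : a ^ n ∈ (1 ⊔ L) ^ n :=
  Submodule.pow_mem_pow _ (Submodule.mem_sup_right ha) n

theorem one_sup_pow_mono {m n : ℕ} (h : m ≤ n) : (1 ⊔ L) ^ m ≤ (1 ⊔ L) ^ n :=
  pow_le_pow_right₀ le_sup_left h

theorem pow_mul_sub_mul_pow_mem (hL : ∀ a ∈ L, ∀ b ∈ L, a * b - b * a ∈ L)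
    {a b : A} (ha : a ∈ L) (hb : b ∈ L) (n : ℕ) :
    a ^ n * b - b * a ^ n ∈ (1 ⊔ L) ^ n := by
  induction n with
  | zero => simp
  | succ n ih =>
    have e : a ^ (n + 1) * b - b * a ^ (n + 1) =
        a * (a ^ n * b - b * a ^ n) + (a * b - b * a) * a ^ n := by
      rw [pow_succ']; noncomm_ring
    rw [e, pow_succ' (1 ⊔ L)]
    exact add_mem (Submodule.mul_mem_mul (Submodule.mem_sup_right ha) ih)
      (Submodule.mul_mem_mul (Submodule.mem_sup_right (hL a ha b hb)) (pow_mem_one_sup_pow ha n))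

theorem exists_add_nsmul_pow_eq (hL : ∀ a ∈ L, ∀ b ∈ L, a * b - b * a ∈ L)
    {a b : A} (ha : a ∈ L) (hb : b ∈ L) (n : ℕ) :
    ∃ c : ℕ → A, (∀ s : ℕ, (a + s • b) ^ (n + 1) = ∑ i ∈ Finset.range (n + 2), s ^ i • c i) ∧
      c 0 = a ^ (n + 1) ∧ c 1 - (n + 1) • (b * a ^ n) ∈ (1 ⊔ L) ^ n := by
  induction n with
  | zero =>
    refine ⟨fun i => if i = 0 then a else b, fun s => ?_, by simp, by simp⟩
    simp [Finset.sum_range_succ]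
  | succ n ih =>
    obtain ⟨c, hc, hc0, hc1⟩ := ih
    refine ⟨fun i => (if i < n + 2 then c i * a else 0) + (if i = 0 then 0 else c (i - 1) * b),
      fun s => ?_, ?_, ?_⟩
    · rw [pow_succ, hc, mul_add, Finset.sum_mul, Finset.sum_mul]
      simp_rw [smul_add]
      rw [Finset.sum_add_distrib]
      congr 1
      · rw [Finset.sum_range_succ _ (n + 2), if_neg (lt_irrefl _), smul_zero, add_zero]
        refine Finset.sum_congr rfl fun i hi => ?_
        rw [if_pos (Finset.mem_range.1 hi), smul_mul_assoc]
      · rw [Finset.sum_range_succ' _ (n + 2)]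
        simp only [if_pos, smul_zero, add_zero, Nat.add_one_ne_zero, if_false,
          Nat.add_sub_cancel]
        refine Finset.sum_congr rfl fun i _ => ?_
        rw [smul_mul_assoc, mul_smul_comm, smul_smul, pow_succ]
    · simp [hc0, pow_succ]
    · have e : (if 1 < n + 2 then c 1 * a else 0) + (if 1 = 0 then 0 else c (1 - 1) * b) -
          (n + 1 + 1) • (b * a ^ (n + 1)) =
          (c 1 - (n + 1) • (b * a ^ n)) * a + (a ^ (n + 1) * b - b * a ^ (n + 1)) := by
        rw [if_pos (by omega), if_neg (by omega), Nat.sub_self, hc0, sub_mul, succ_nsmul _ (n + 1),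
          smul_mul_assoc, mul_assoc b, ← pow_succ]
        abel
      simp only [e]
      refine add_mem ?_ (pow_mul_sub_mul_pow_mem hL ha hb _)
      rw [pow_succ (1 ⊔ L)]
      exact Submodule.mul_mem_mul hc1 (Submodule.mem_sup_right ha)

/-- Symmetrization: products of at most `n` elements of a Lie subalgebra `L` are combinations of
`j`-th powers of elements of `L` with `j ≤ n`. -/
theorem one_sup_pow_le_powSpan (hL : ∀ a ∈ L, ∀ b ∈ L, a * b - b * a ∈ L)
    [Algebra ℚ K] (n : ℕ) : (1 ⊔ L) ^ n ≤ powSpan L n := by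
  induction n with
  | zero =>
    rw [pow_zero, Submodule.one_eq_span, powSpan]
    refine Submodule.span_mono ?_
    rintro _ rfl
    exact ⟨0, L.zero_mem, 0, le_rfl, pow_zero _⟩
  | succ n ih =>
    rw [pow_succ', Submodule.mul_le]
    intro y hy x hx
    obtain ⟨r, hr, b, hb, rfl⟩ := Submodule.mem_sup.1 hy
    obtain ⟨r, rfl⟩ := Submodule.mem_one.1 hr
    rw [add_mul, ← Algebra.smul_def]
    refine add_mem (Submodule.smul_mem _ _ (powSpan_mono L n.le_succ (ih hx))) ?_
    have hx' := ih hx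
    clear hx hy
    unfold powSpan at hx'
    induction hx' using Submodule.span_induction with
    | zero => simp
    | add u v _ _ hu hv => rw [mul_add]; exact add_mem hu hv
    | smul r u _ hu => rw [mul_smul_comm]; exact Submodule.smul_mem _ _ hu
    | mem u hu =>
      obtain ⟨a, ha, j, hj, rfl⟩ := hu
      obtain ⟨c, hc, -, hc1⟩ := exists_add_nsmul_pow_eq hL ha hb j
      have h1 : c 1 ∈ powSpan L (n + 1) := by
        refine coeff_mem_of_forall_sum_mem (powSpan L (n + 1)) (j + 2) c (fun s => ?_) (by omega)
        rw [← hc]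
        exact Submodule.subset_span
          ⟨_, L.add_mem ha (L.smul_of_tower_mem s hb), j + 1, by omega, rfl⟩
      have h2 : (j + 1) • (b * a ^ j) ∈ powSpan L (n + 1) := by
        have := sub_mem h1 (powSpan_mono L n.le_succ (ih (one_sup_pow_mono hj hc1)))
        simpa using this
      rw [← invNat_smul_nsmul K j.succ_pos (b * a ^ j)]
      exact Submodule.smul_mem _ _ h2

end Powers

section Primitive

theorem aeval_apply_of_apply_eq_smul {K V : Type*} [CommRing K] [AddCommGroup V] [Module K V]
    {f : Module.End K V} {μ : K} {x : V} (h : f x = μ • x) (q : Polynomial K) :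
    Polynomial.aeval f q x = q.eval μ • x := by
  induction q using Polynomial.induction_on with
  | C a => simp [Module.algebraMap_end_apply]
  | add p q hp hq => simp [hp, hq, add_smul]
  | monomial n a hna =>
    rw [mul_comm, pow_succ', mul_assoc, map_mul, Module.End.mul_apply, mul_comm, hna]
    simp only [Polynomial.aeval_X, Polynomial.eval_mul, Polynomial.eval_C, Polynomial.eval_pow,
      Polynomial.eval_X, map_smul, h, smul_smul]
    ring_nf

theorem mul'_comul_pow {K A : Type*} [CommRing K] [Ring A] [Bialgebra K A] {a : A}
    (ha : Coalgebra.comul (R := K) a = 1 ⊗ₜ[K] a + a ⊗ₜ[K] 1) (n : ℕ) :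
    LinearMap.mul' K A (Coalgebra.comul (R := K) (a ^ n)) = (2 : K) ^ n • a ^ n := by
  have hc : Commute (1 ⊗ₜ[K] a) (a ⊗ₜ[K] 1 : A ⊗[K] A) := by
    simp [Commute, SemiconjBy]
  rw [Bialgebra.comul_pow, ha, hc.add_pow', map_sum]
  have : ∀ p ∈ Finset.HasAntidiagonal.antidiagonal n,
      LinearMap.mul' K A (n.choose p.1 • ((1 ⊗ₜ[K] a) ^ p.1 * (a ⊗ₜ[K] 1) ^ p.2)) =
        n.choose p.1 • a ^ n := by
    intro p hp
    rw [← Finset.HasAntidiagonal.mem_antidiagonal.1 hp, map_nsmul]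
    simp [← pow_add, add_comm]
  rw [Finset.sum_congr rfl this, ← Finset.sum_smul, Finset.Nat.sum_antidiagonal_eq_sum_range_succ_mk,
    Nat.sum_range_choose, ← Nat.cast_smul_eq_nsmul K]
  push_cast
  rfl

theorem isUnit_two_sub_two_pow (K : Type*) [CommRing K] [Algebra ℚ K] {j : ℕ} (hj : j ≠ 1) :
    IsUnit ((2 : K) - 2 ^ j) := by
  have h : ((2 : ℚ) - 2 ^ j) ≠ 0 := by
    intro h
    have : (2 : ℚ) ^ 1 = 2 ^ j := by linarith
    exact hj (pow_right_injective₀ (by norm_num) (by norm_num) this).symm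
  have := (isUnit_iff_ne_zero.2 h).map (algebraMap ℚ K)
  rwa [map_sub, map_pow, map_ofNat] at this

attribute [local instance 100] LieRing.ofAssociativeRing

/-- Over a `ℚ`-algebra, the primitive elements of an enveloping algebra belong to the Lie algebra. -/
theorem UniversalEnvelopingAlgebra.exists_ι_eq_of_primitive {K L : Type*} [CommRing K] [Algebra ℚ K]
    [LieRing L] [LieAlgebra K L] {x : UniversalEnvelopingAlgebra K L}
    (hx : Coalgebra.comul (R := K) x = 1 ⊗ₜ[K] x + x ⊗ₜ[K] 1) :
    ∃ δ : L, UniversalEnvelopingAlgebra.ι K δ = x := by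
  let U := UniversalEnvelopingAlgebra K L
  let N : Submodule K U := LinearMap.range (ι K : L →ₗ⁅K⁆ U).toLinearMap
  have hN : ∀ a ∈ N, ∀ b ∈ N, a * b - b * a ∈ N := by
    rintro _ ⟨a, rfl⟩ _ ⟨b, rfl⟩
    exact ⟨⁅a, b⁆, (LieHom.map_lie _ _ _).trans (LieRing.of_associative_ring_bracket _ _)⟩
  have hfil : ∀ y : U, ∃ n, y ∈ (1 ⊔ N) ^ n := by
    intro y
    have hy : y ∈ Algebra.adjoin K (Set.range (ι K : L → U)) := by
      rw [adjoin_range_ι]; trivial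
    induction hy using Algebra.adjoin_induction with
    | mem y hy =>
      obtain ⟨a, rfl⟩ := hy
      exact ⟨1, by rw [pow_one]; exact Submodule.mem_sup_right ⟨a, rfl⟩⟩
    | algebraMap r => exact ⟨0, by rw [pow_zero]; exact Submodule.mem_one.2 ⟨r, rfl⟩⟩
    | add y z _ _ hy hz =>
      obtain ⟨m, hm⟩ := hy
      obtain ⟨n, hn⟩ := hz
      exact ⟨max m n, add_mem (one_sup_pow_mono (le_max_left _ _) hm)
        (one_sup_pow_mono (le_max_right _ _) hn)⟩
    | mul y z _ _ hy hz =>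
      obtain ⟨m, hm⟩ := hy
      obtain ⟨n, hn⟩ := hz
      exact ⟨m + n, by rw [pow_add]; exact Submodule.mul_mem_mul hm hn⟩
  obtain ⟨n, hn⟩ := hfil x
  have hn := one_sup_pow_le_powSpan hN n hn
  let ψ : Module.End K U := LinearMap.mul' K U ∘ₗ Coalgebra.comul
  let q : Polynomial K := ∏ j ∈ (Finset.range (n + 1)).erase 1, (Polynomial.X - Polynomial.C (2 ^ j))
  have hq : q.eval 2 = ∏ j ∈ (Finset.range (n + 1)).erase 1, ((2 : K) - 2 ^ j) := by
    simp [q, Polynomial.eval_prod]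
  have hunit : IsUnit (q.eval 2) := by
    rw [hq, IsUnit.prod_iff]
    intro j hj
    exact isUnit_two_sub_two_pow K (Finset.ne_of_mem_erase hj)
  have hψx : ψ x = (2 : K) • x := by
    have := mul'_comul_pow hx 1
    rwa [pow_one, pow_one] at this
  have hmem : ∀ y ∈ powSpan N n, Polynomial.aeval ψ q y ∈ N := by
    intro y hy
    unfold powSpan at hy
    induction hy using Submodule.span_induction with
    | zero => simp
    | add u v _ _ hu hv => rw [map_add]; exact add_mem hu hv
    | smul r u _ hu => rw [map_smul]; exact N.smul_mem _ hu
    | mem u hu =>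
      obtain ⟨_, ⟨a, rfl⟩, j, hj, rfl⟩ := hu
      have := aeval_apply_of_apply_eq_smul (f := ψ) (mul'_comul_pow (comul_ι K L a) j) q
      refine this ▸ ?_
      rcases eq_or_ne j 1 with rfl | h1
      · exact N.smul_mem _ ⟨a, (pow_one _).symm⟩
      · have : q.eval (2 ^ j) = 0 := by
          rw [Polynomial.eval_prod]
          exact Finset.prod_eq_zero (Finset.mem_erase.2 ⟨h1, Finset.mem_range.2 (by omega)⟩)
            (by simp)
        rw [this, zero_smul]
        exact N.zero_mem
  have h := hmem x hn
  rw [aeval_apply_of_apply_eq_smul hψx q] at h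
  obtain ⟨u, hu⟩ := hunit
  have h' := N.smul_mem (↑u⁻¹ : K) h
  rw [← hu, smul_smul, Units.inv_mul, one_smul] at h'
  exact h'

end Primitive

end

noncomputable section

open Finset.HasAntidiagonal (antidiagonal mem_antidiagonal)

namespace Mon

variable {k : VarKind} {n : ℕ}

theorem degree_zero : (0 : Mon k n).degree = 0 := by
  cases k
  · exact Finset.sum_const_zero
  · rfl

theorem degree_add (v w : Mon k n) : (v + w).degree = v.degree + w.degree := by
  cases k
  · exact Finset.sum_add_distrib
  · exact FreeAddMonoid.length_add _ _

theorem degree_var (i : Fin n) : (var i : Mon k n).degree = 1 := by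
  cases k
  · change ∑ j, Finsupp.single i 1 j = 1
    simp [Finsupp.single_apply]
  · exact FreeAddMonoid.length_of _

theorem eq_zero_of_degree_eq_zero {w : Mon k n} (h : w.degree = 0) : w = 0 := by
  cases k
  · refine Finsupp.ext fun i => ?_
    exact Finset.sum_eq_zero_iff.1 h i (Finset.mem_univ i)
  · exact FreeAddMonoid.length_eq_zero.1 h

theorem add_left_cancel {u v w : Mon k n} (h : u + v = u + w) : v = w := by
  cases k
  · exact _root_.add_left_cancel (G := Fin n →₀ ℕ) h
  · exact List.append_cancel_left (α := Fin n) h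

theorem exists_eq_var_add {w : Mon k n} (h : w ≠ 0) : ∃ i v, w = var i + v := by
  cases k
  · obtain ⟨i, hi⟩ := Finsupp.ne_iff.1 h
    refine ⟨i, (show Fin n →₀ ℕ from w) - Finsupp.single i 1, ?_⟩
    refine (add_tsub_cancel_of_le (α := Fin n →₀ ℕ) ?_).symm
    exact Finsupp.single_le_iff.2 (Nat.one_le_iff_ne_zero.2 hi)
  · change FreeAddMonoid (Fin n) at w
    induction w using FreeAddMonoid.casesOn with
    | zero => exact absurd rfl h
    | of_add i v => exact ⟨i, v, rfl⟩

end Mon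

section Order

variable {k : VarKind} {n : ℕ} {R : Type*} [CommRing R]

theorem OrdGE.mono {a b : ℕ} {u : Zser k n R} (h : OrdGE b u) (hab : a ≤ b) : OrdGE a u :=
  fun w hw => h w (hw.trans_le hab)

theorem ordGE_zero (u : Zser k n R) : OrdGE 0 u := fun _ hw => absurd hw (Nat.not_lt_zero _)

theorem OrdGE.add {a : ℕ} {u v : Zser k n R} (hu : OrdGE a u) (hv : OrdGE a v) :
    OrdGE a (u + v) := fun w hw => by
  rw [FormalSeries.add_apply, hu w hw, hv w hw, add_zero]

theorem OrdGE.sum {ι : Type*} {s : Finset ι} {a : ℕ} {u : ι → Zser k n R}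
    (hu : ∀ i ∈ s, OrdGE a (u i)) : OrdGE a (∑ i ∈ s, u i) :=
  Finset.sum_induction _ _ (fun _ _ => OrdGE.add) (fun _ _ => rfl) hu

theorem OrdGE.mul {a b : ℕ} {u v : Zser k n R} (hu : OrdGE a u) (hv : OrdGE b v) :
    OrdGE (a + b) (u * v) := fun w hw => by
  rw [FormalSeries.mul_apply]
  refine Finset.sum_eq_zero fun p hp => ?_
  have h := congrArg Mon.degree (mem_antidiagonal.1 hp)
  rw [Mon.degree_add] at h
  rcases Nat.lt_or_ge p.1.degree a with h1 | h1
  · rw [hu _ h1, zero_mul]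
  · rw [hv _ (by omega), mul_zero]

theorem ordGE_one_iff {u : Zser k n R} : OrdGE 1 u ↔ u 0 = 0 := by
  refine ⟨fun h => h 0 (by rw [Mon.degree_zero]; exact Nat.one_pos), fun h w hw => ?_⟩
  rw [Mon.eq_zero_of_degree_eq_zero (Nat.lt_one_iff.1 hw), h]

theorem ordGE_one_zvar (i : Fin n) : OrdGE 1 (zvar i : Zser k n R) := fun w hw => by
  rw [zvar, FormalSeries.monomial, if_neg]
  rintro rfl
  rw [Mon.degree_var] at hw
  exact lt_irrefl _ hw

theorem eq_zero_of_forall_ordGE {u : Zser k n R} (h : ∀ m, OrdGE m u) : u = 0 :=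
  FormalSeries.ext fun w => h (w.degree + 1) w (Nat.lt_succ_self _)

theorem zvar_mul_apply_var_add (i : Fin n) (q : Zser k n R) (v : Mon k n) :
    (zvar i * q : Zser k n R) (Mon.var i + v) = q v := by
  rw [FormalSeries.mul_apply, Finset.sum_eq_single (Mon.var i, v)]
  · simp [zvar, FormalSeries.monomial]
  · rintro ⟨a, b⟩ h hne
    rw [mem_antidiagonal] at h
    rw [zvar, FormalSeries.monomial, if_neg, zero_mul]
    rintro rfl
    exact hne (Prod.ext rfl (Mon.add_left_cancel h))
  · intro h
    exact absurd (mem_antidiagonal.2 rfl) h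

theorem zvar_mul_apply_of_forall_ne (i : Fin n) (q : Zser k n R) {w : Mon k n}
    (h : ∀ v, Mon.var i + v ≠ w) : (zvar i * q : Zser k n R) w = 0 := by
  rw [FormalSeries.mul_apply]
  refine Finset.sum_eq_zero fun p hp => ?_
  rw [zvar, FormalSeries.monomial, if_neg, zero_mul]
  intro h1
  exact h p.2 (h1 ▸ mem_antidiagonal.1 hp)

theorem FormalSeries.sum_apply {ι M R : Type*} [CommRing R] (s : Finset ι) (u : ι → FormalSeries M R) (w : M) :
    (∑ i ∈ s, u i) w = ∑ i ∈ s, u i w :=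
  Finset.sum_apply w s u

/-- Every series is its constant term plus a combination of the variables. -/
theorem exists_eq_smul_one_add_sum_zvar_mul (u : Zser k n R) :
    ∃ q : Fin n → Zser k n R, u = u 0 • 1 + ∑ i, zvar i * q i ∧
      ∀ m, OrdGE (m + 1) u → ∀ i, OrdGE m (q i) := by
  classical
  have hf : ∀ w : Mon k n, ∃ p : Option (Fin n), w ≠ 0 → ∃ i v, p = some i ∧ w = Mon.var i + v := by
    intro w
    by_cases h : w = 0
    · exact ⟨none, fun h' => absurd h h'⟩
    · obtain ⟨i, v, hv⟩ := Mon.exists_eq_var_add h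
      exact ⟨some i, fun _ => ⟨i, v, rfl, hv⟩⟩
  choose f hf using hf
  have hne : ∀ (i : Fin n) (v : Mon k n), Mon.var i + v ≠ 0 := by
    intro i v h
    have := congrArg Mon.degree h
    rw [Mon.degree_add, Mon.degree_var, Mon.degree_zero] at this
    omega
  obtain ⟨q, hq⟩ : ∃ q : Fin n → Zser k n R, ∀ i v,
      q i v = if f (Mon.var i + v) = some i then u (Mon.var i + v) else 0 :=
    ⟨fun i v => if f (Mon.var i + v) = some i then u (Mon.var i + v) else 0, fun _ _ => rfl⟩
  refine ⟨q, ?_, ?_⟩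
  · ext w
    rw [FormalSeries.add_apply, FormalSeries.smul_apply, FormalSeries.one_apply,
      FormalSeries.sum_apply]
    by_cases hw : w = 0
    · subst hw
      rw [Finset.sum_eq_zero fun i _ => zvar_mul_apply_of_forall_ne i _ (hne i)]
      simp
    · obtain ⟨i, v, hi, rfl⟩ := hf w hw
      rw [if_neg hw, smul_zero, zero_add, Finset.sum_eq_single i, zvar_mul_apply_var_add, hq,
        if_pos hi]
      · intro j _ hj
        by_cases h : ∃ v', Mon.var j + v' = Mon.var i + v
        · obtain ⟨v', hv'⟩ := h
          rw [← hv', zvar_mul_apply_var_add, hq, if_neg]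
          rw [hv', hi]
          exact fun h => hj (Option.some.inj h).symm
        · exact zvar_mul_apply_of_forall_ne j _ fun v' hv' => h ⟨v', hv'⟩
      · exact fun h => absurd (Finset.mem_univ i) h
  · intro m hm i v hv
    have := hm (Mon.var i + v) (by rw [Mon.degree_add, Mon.degree_var]; omega)
    rw [hq, this, ite_self]

/-- A derivation which increases the degrees of the variables by at least `α - 1` increases all
degrees by at least `α - 1`. -/
theorem ordGE_of_leibniz {α : ℕ} (hα : 1 ≤ α) {δ : Zser k n R →ₗ[R] Zser k n R}
    (hmul : ∀ f g, δ (f * g) = δ f * g + f * δ g) (hz : ∀ i, OrdGE α (δ (zvar i)))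
    (m : ℕ) (u : Zser k n R) (hu : OrdGE m u) : OrdGE (m + (α - 1)) (δ u) := by
  have hone : δ 1 = 0 := by simpa using hmul 1 1
  have key : ∀ j m u, OrdGE m u → OrdGE (min j (m + (α - 1))) (δ u) := by
    intro j
    induction j with
    | zero => intro m u _; exact (ordGE_zero _).mono (min_le_left _ _)
    | succ j ih =>
      intro m u hu
      obtain ⟨q, hq, hord⟩ := exists_eq_smul_one_add_sum_zvar_mul u
      obtain ⟨m', hm', hm⟩ : ∃ m', (∀ i, OrdGE m' (q i)) ∧ m ≤ m' + 1 := by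
        rcases m with _ | m
        · exact ⟨0, fun i => ordGE_zero _, by omega⟩
        · exact ⟨m, hord m hu, le_rfl⟩
      have e : δ u = ∑ i, (δ (zvar i) * q i + zvar i * δ (q i)) := by
        conv_lhs => rw [hq]
        rw [map_add, map_smul, hone, smul_zero, zero_add, map_sum]
        exact Finset.sum_congr rfl fun i _ => hmul _ _
      rw [e]
      refine OrdGE.sum fun i _ => ((hz i).mul (hm' i)).mono ?_ |>.add
        (((ordGE_one_zvar i).mul (ih _ _ (hm' i))).mono ?_)
      · omega
      · omega
  intro w hw
  exact key (w.degree + 1) m u hu w (by omega)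

/-- A derivation is determined by its values on the variables. -/
theorem eq_of_leibniz_of_zvar {δ δ' : Zser k n R →ₗ[R] Zser k n R}
    (h : ∀ f g, δ (f * g) = δ f * g + f * δ g) (h' : ∀ f g, δ' (f * g) = δ' f * g + f * δ' g)
    (hz : ∀ i, δ (zvar i) = δ' (zvar i)) : δ = δ' := by
  refine sub_eq_zero.1 (LinearMap.ext fun u => eq_zero_of_forall_ordGE fun m => ?_)
  refine (ordGE_of_leibniz (α := m + 1) (by omega) (δ := δ - δ') (fun f g => ?_) (fun i => ?_) 0 u
    (ordGE_zero u)).mono (by omega)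
  · simp only [LinearMap.sub_apply, h, h', sub_mul, mul_sub]
    abel
  · rw [LinearMap.sub_apply, hz, sub_self]
    exact fun _ _ => rfl

theorem AlgHom.apply_eq_smul_one_add (F : Zser k n R →ₐ[R] Zser k n R) {u : Zser k n R}
    {q : Fin n → Zser k n R} (hq : u = u 0 • 1 + ∑ i, zvar i * q i) :
    F u = u 0 • 1 + ∑ i, F (zvar i) * F (q i) := by
  conv_lhs => rw [hq]
  rw [map_add, map_smul, map_one, map_sum]
  simp only [map_mul]

theorem AlgHom.apply_apply_zero {F : Zser k n R →ₐ[R] Zser k n R}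
    (hz : ∀ i, OrdGE 1 (F (zvar i))) (u : Zser k n R) : F u 0 = u 0 := by
  classical
  obtain ⟨q, hq, -⟩ := exists_eq_smul_one_add_sum_zvar_mul u
  rw [AlgHom.apply_eq_smul_one_add F hq, FormalSeries.add_apply, FormalSeries.smul_apply,
    FormalSeries.one_apply, if_pos rfl, FormalSeries.sum_apply, Finset.sum_eq_zero, add_zero,
    smul_eq_mul, mul_one]
  intro i _
  exact ordGE_one_iff.1 (((hz i).mul (ordGE_zero (F (q i)))).mono le_rfl)

theorem AlgHom.ordGE_apply {F : Zser k n R →ₐ[R] Zser k n R}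
    (hz : ∀ i, OrdGE 1 (F (zvar i))) (m : ℕ) {u : Zser k n R} (hu : OrdGE m u) :
    OrdGE m (F u) := by
  induction m generalizing u with
  | zero => exact ordGE_zero _
  | succ m ih =>
    obtain ⟨q, hq, hord⟩ := exists_eq_smul_one_add_sum_zvar_mul u
    rw [AlgHom.apply_eq_smul_one_add F hq, ordGE_one_iff.1 (hu.mono (by omega)), zero_smul, zero_add]
    exact OrdGE.sum fun i _ => ((hz i).mul (ih (hord m hu i))).mono (by omega)

/-- An endomorphism fixing the variables is the identity. -/
theorem AlgHom.eq_id_of_zvar {F : Zser k n R →ₐ[R] Zser k n R}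
    (hz : ∀ i, F (zvar i) = zvar i) (u : Zser k n R) : F u = u := by
  refine sub_eq_zero.1 (eq_zero_of_forall_ordGE fun m => ?_)
  induction m generalizing u with
  | zero => exact ordGE_zero _
  | succ m ih =>
    obtain ⟨q, hq, -⟩ := exists_eq_smul_one_add_sum_zvar_mul u
    have e : F u - u = ∑ i, zvar i * (F (q i) - q i) := by
      rw [AlgHom.apply_eq_smul_one_add F hq]
      nth_rw 2 [hq]
      rw [add_sub_add_left_eq_sub, ← Finset.sum_sub_distrib]
      simp only [hz, mul_sub]
    rw [e]
    exact OrdGE.sum fun i _ => ((ordGE_one_zvar i).mul (ih (q i))).mono (by omega)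

end Order

end

noncomputable section

open Finset.HasAntidiagonal (antidiagonal mem_antidiagonal)

section CoeffT

variable {k : VarKind} {n : ℕ} {K : Type*} [CommRing K]

/-- A series in `z`, regarded as a series in `z` and `t` which does not depend on `t`. -/
def constT (u : Zser k n K) : Zsert k n K := fun w => PowerSeries.C (u w)

theorem coeffT_apply (m : ℕ) (u : Zsert k n K) (w : Mon k n) :
    coeffT m u w = PowerSeries.coeff m (u w) := rfl

theorem constT_apply (u : Zser k n K) (w : Mon k n) : constT u w = PowerSeries.C (u w) := rfl

theorem derivT_apply (u : Zsert k n K) (w : Mon k n) :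
    derivT u w = PowerSeries.derivative K (u w) := rfl

theorem coeffT_ext {u v : Zsert k n K} (h : ∀ m, coeffT m u = coeffT m v) : u = v :=
  FormalSeries.ext fun w => PowerSeries.ext fun m => congrFun (h m) w

theorem coeffT_add (m : ℕ) (u v : Zsert k n K) :
    coeffT m (u + v) = coeffT m u + coeffT m v :=
  FormalSeries.ext fun w => map_add (PowerSeries.coeff m) (u w) (v w)

theorem coeffT_zero (m : ℕ) : coeffT m (0 : Zsert k n K) = 0 :=
  FormalSeries.ext fun _ => map_zero (PowerSeries.coeff m)

theorem coeffT_sub (m : ℕ) (u v : Zsert k n K) :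
    coeffT m (u - v) = coeffT m u - coeffT m v :=
  FormalSeries.ext fun w => map_sub (PowerSeries.coeff m) (u w) (v w)

theorem coeffT_neg (m : ℕ) (u : Zsert k n K) : coeffT m (-u) = -coeffT m u :=
  FormalSeries.ext fun w => map_neg (PowerSeries.coeff m) (u w)

theorem coeffT_sum {ι : Type*} (m : ℕ) (s : Finset ι) (u : ι → Zsert k n K) :
    coeffT m (∑ i ∈ s, u i) = ∑ i ∈ s, coeffT m (u i) :=
  map_sum (⟨⟨coeffT m, coeffT_zero m⟩, coeffT_add m⟩ : Zsert k n K →+ Zser k n K) u s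

theorem coeffT_C_smul (m : ℕ) (c : K) (u : Zsert k n K) :
    coeffT m ((PowerSeries.C c : PowerSeries K) • u) = c • coeffT m u :=
  FormalSeries.ext fun w => PowerSeries.coeff_C_mul m (u w) c

theorem coeffT_X_pow_smul (m j : ℕ) (u : Zsert k n K) :
    coeffT m ((PowerSeries.X ^ j : PowerSeries K) • u) =
      if j ≤ m then coeffT (m - j) u else 0 := by
  ext w
  rw [coeffT_apply, FormalSeries.smul_apply, smul_eq_mul, PowerSeries.coeff_X_pow_mul']
  split_ifs <;> rfl

theorem coeffT_constT (m : ℕ) (u : Zser k n K) :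
    coeffT m (constT u) = if m = 0 then u else 0 := by
  ext w
  rw [coeffT_apply, constT_apply, PowerSeries.coeff_C]
  split_ifs <;> rfl

theorem coeffT_zero_constT (u : Zser k n K) : coeffT 0 (constT u) = u := by
  rw [coeffT_constT, if_pos rfl]

theorem coeffT_mul (m : ℕ) (u v : Zsert k n K) :
    coeffT m (u * v) = ∑ p ∈ antidiagonal m, coeffT p.1 u * coeffT p.2 v := by
  ext w
  rw [coeffT_apply, FormalSeries.mul_apply, map_sum, FormalSeries.sum_apply]
  simp_rw [FormalSeries.mul_apply, PowerSeries.coeff_mul]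
  rw [Finset.sum_comm]
  rfl

theorem coeffT_zero_mul (u v : Zsert k n K) : coeffT 0 (u * v) = coeffT 0 u * coeffT 0 v := by
  rw [coeffT_mul, Finset.Nat.antidiagonal_zero, Finset.sum_singleton]

theorem coeffT_mul_constT (m : ℕ) (u : Zsert k n K) (v : Zser k n K) :
    coeffT m (u * constT v) = coeffT m u * v := by
  rw [coeffT_mul, Finset.sum_eq_single (m, 0)]
  · rw [coeffT_zero_constT]
  · rintro ⟨i, j⟩ h hne
    rw [coeffT_constT, if_neg, mul_zero]
    rintro rfl
    exact hne (Prod.ext (by simpa using mem_antidiagonal.1 h) rfl)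
  · intro h
    exact absurd (mem_antidiagonal.2 (add_zero m)) h

theorem coeffT_constT_mul (m : ℕ) (u : Zser k n K) (v : Zsert k n K) :
    coeffT m (constT u * v) = u * coeffT m v := by
  rw [coeffT_mul, Finset.sum_eq_single (0, m)]
  · rw [coeffT_zero_constT]
  · rintro ⟨i, j⟩ h hne
    rw [coeffT_constT, if_neg, zero_mul]
    rintro rfl
    exact hne (Prod.ext rfl (by simpa using mem_antidiagonal.1 h))
  · intro h
    exact absurd (mem_antidiagonal.2 (zero_add m)) h

theorem constT_mul (u v : Zser k n K) : constT (u * v) = constT u * constT v := by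
  refine coeffT_ext fun m => ?_
  rw [coeffT_mul_constT, coeffT_constT, coeffT_constT]
  split_ifs <;> simp

theorem constT_add (u v : Zser k n K) : constT (u + v) = constT u + constT v :=
  FormalSeries.ext fun w => map_add PowerSeries.C (u w) (v w)

theorem constT_smul (c : K) (u : Zser k n K) :
    constT (c • u) = (PowerSeries.C c : PowerSeries K) • constT u :=
  FormalSeries.ext fun w => map_mul PowerSeries.C c (u w)

theorem constT_one : constT (1 : Zser k n K) = 1 := by
  classical
  ext1 w
  rw [constT_apply, FormalSeries.one_apply, FormalSeries.one_apply]
  split_ifs <;> simp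

theorem constT_zvar (i : Fin n) : constT (zvar i : Zser k n K) = zvar i := by
  ext1 w
  rw [constT_apply, zvar, zvar, FormalSeries.monomial, FormalSeries.monomial]
  split_ifs <;> simp

theorem OrdGE.coeffT {a : ℕ} {u : Zsert k n K} (hu : OrdGE a u) (m : ℕ) :
    OrdGE a (coeffT m u) := fun w hw => by
  rw [coeffT_apply, hu w hw, map_zero]

theorem OrdGE.derivT {a : ℕ} {u : Zsert k n K} (hu : OrdGE a u) : OrdGE a (derivT u) :=
  fun w hw => by rw [derivT_apply, hu w hw, map_zero]

theorem derivT_add (u v : Zsert k n K) : derivT (u + v) = derivT u + derivT v :=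
  FormalSeries.ext fun w => map_add (PowerSeries.derivative K) (u w) (v w)

theorem derivT_sub (u v : Zsert k n K) : derivT (u - v) = derivT u - derivT v :=
  FormalSeries.ext fun w => map_sub (PowerSeries.derivative K) (u w) (v w)

theorem derivT_smul (c : PowerSeries K) (u : Zsert k n K) :
    derivT (c • u) = c • derivT u + PowerSeries.derivative K c • u := by
  ext1 w
  rw [derivT_apply, FormalSeries.smul_apply, smul_eq_mul, Derivation.leibniz, smul_eq_mul,
    smul_eq_mul, mul_comm (u w)]
  rfl

theorem derivT_mul (u v : Zsert k n K) : derivT (u * v) = derivT u * v + u * derivT v := by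
  ext1 w
  rw [derivT_apply, FormalSeries.add_apply, FormalSeries.mul_apply, FormalSeries.mul_apply,
    FormalSeries.mul_apply, map_sum, ← Finset.sum_add_distrib]
  refine Finset.sum_congr rfl fun p _ => ?_
  rw [Derivation.leibniz, smul_eq_mul, smul_eq_mul, derivT_apply, derivT_apply, add_comm,
    mul_comm (v p.2)]

theorem derivT_constT (u : Zser k n K) : derivT (constT u) = 0 := by
  ext1 w
  rw [derivT_apply, constT_apply, PowerSeries.derivative_C]
  rfl

theorem coeffT_derivT (m : ℕ) (u : Zsert k n K) :
    coeffT m (derivT u) = (m + 1) • coeffT (m + 1) u := by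
  ext1 w
  rw [coeffT_apply, derivT_apply, PowerSeries.coeff_derivative, ← Nat.cast_smul_eq_nsmul K,
    FormalSeries.smul_apply, coeffT_apply, smul_eq_mul, mul_comm]
  push_cast
  rfl

theorem eq_sum_add_X_pow_smul (N : ℕ) (u : Zsert k n K) :
    ∃ v, u = ∑ j ∈ Finset.range N, (PowerSeries.X ^ j : PowerSeries K) • constT (coeffT j u) +
      (PowerSeries.X ^ N : PowerSeries K) • v := by
  let v : Zsert k n K := fun w => PowerSeries.mk fun i => PowerSeries.coeff (i + N) (u w)
  have hv : ∀ i, coeffT i v = coeffT (i + N) u := fun i =>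
    FormalSeries.ext fun w => PowerSeries.coeff_mk _ _
  refine ⟨v, coeffT_ext fun m => ?_⟩
  rw [coeffT_add, coeffT_sum]
  simp_rw [coeffT_X_pow_smul, coeffT_constT, hv]
  by_cases h : N ≤ m
  · rw [if_pos h, Nat.sub_add_cancel h, Finset.sum_eq_zero, zero_add]
    intro j hj
    have := Finset.mem_range.1 hj
    rw [if_pos (by omega), if_neg (by omega)]
  · rw [if_neg h, add_zero, Finset.sum_eq_single m]
    · simp
    · intro j _ hj
      split_ifs with h1 h2
      · omega
      · rfl
      · rfl
    · intro hm
      exact absurd (Finset.mem_range.2 (by omega)) hm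

end CoeffT

section OpSeries

variable {k : VarKind} {n : ℕ} {K : Type*} [CommRing K]

/-- The coefficients of a `K[[t]]`-linear operator on `K[[t]]⟨⟨z⟩⟩`. -/
def opCoeff (L : Zsert k n K →ₗ[PowerSeries K] Zsert k n K) (m : ℕ) :
    Module.End K (Zser k n K) where
  toFun u := coeffT m (L (constT u))
  map_add' u v := by rw [constT_add, map_add, coeffT_add]
  map_smul' c u := by rw [constT_smul, map_smul, coeffT_C_smul, RingHom.id_apply]

theorem opCoeff_apply (L : Zsert k n K →ₗ[PowerSeries K] Zsert k n K) (m : ℕ) (u : Zser k n K) :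
    opCoeff L m u = coeffT m (L (constT u)) := rfl

theorem coeffT_apply_eq_sum (L : Zsert k n K →ₗ[PowerSeries K] Zsert k n K) (m : ℕ)
    (u : Zsert k n K) :
    coeffT m (L u) = ∑ p ∈ antidiagonal m, opCoeff L p.1 (coeffT p.2 u) := by
  obtain ⟨v, hv⟩ := eq_sum_add_X_pow_smul (m + 1) u
  rw [← Finset.Nat.sum_antidiagonal_swap,
    Finset.Nat.sum_antidiagonal_eq_sum_range_succ_mk]
  conv_lhs => rw [hv]
  rw [map_add, map_smul, coeffT_add, coeffT_X_pow_smul, if_neg (by omega), add_zero, map_sum,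
    coeffT_sum]
  refine Finset.sum_congr rfl fun j hj => ?_
  rw [map_smul, coeffT_X_pow_smul, if_pos (by have := Finset.mem_range.1 hj; omega)]
  rfl

/-- A `K[[t]]`-linear operator on `K[[t]]⟨⟨z⟩⟩`, as a series in `t` of operators on `K⟨⟨z⟩⟩`. -/
def opSeries (L : Zsert k n K →ₗ[PowerSeries K] Zsert k n K) :
    PowerSeries (Module.End K (Zser k n K)) :=
  PowerSeries.mk (opCoeff L)

theorem coeff_opSeries (L : Zsert k n K →ₗ[PowerSeries K] Zsert k n K) (m : ℕ) :
    PowerSeries.coeff m (opSeries L) = opCoeff L m :=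
  PowerSeries.coeff_mk _ _

theorem opSeries_comp (L L' : Zsert k n K →ₗ[PowerSeries K] Zsert k n K) :
    opSeries (L ∘ₗ L') = opSeries L * opSeries L' := by
  ext1 m
  refine LinearMap.ext fun u => ?_
  rw [coeff_opSeries, opCoeff_apply, LinearMap.comp_apply, coeffT_apply_eq_sum,
    PowerSeries.coeff_mul, LinearMap.sum_apply]
  refine Finset.sum_congr rfl fun p _ => ?_
  rw [coeff_opSeries, coeff_opSeries]
  rfl

theorem opSeries_id : opSeries (LinearMap.id : Zsert k n K →ₗ[PowerSeries K] Zsert k n K) = 1 := by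
  ext1 m
  refine LinearMap.ext fun u => ?_
  rw [coeff_opSeries, opCoeff_apply, LinearMap.id_apply, coeffT_constT, PowerSeries.coeff_one]
  split_ifs <;> rfl

variable (F : Zsert k n K ≃ₐ[PowerSeries K] Zsert k n K)

/-- The operator `F ∘ ∂/∂t ∘ F⁻¹ - ∂/∂t`. -/
def conjDeriv : Zsert k n K →ₗ[PowerSeries K] Zsert k n K where
  toFun u := F (derivT (F.symm u)) - derivT u
  map_add' u v := by
    simp only [map_add, derivT_add]
    abel
  map_smul' c u := by
    simp only [map_smul, derivT_smul, map_add, AlgEquiv.apply_symm_apply, RingHom.id_apply,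
      smul_sub]
    abel

theorem conjDeriv_apply (u : Zsert k n K) :
    conjDeriv F u = F (derivT (F.symm u)) - derivT u := rfl

theorem conjDeriv_mul (u v : Zsert k n K) :
    conjDeriv F (u * v) = conjDeriv F u * v + u * conjDeriv F v := by
  simp only [conjDeriv_apply, map_mul, derivT_mul, map_add, AlgEquiv.apply_symm_apply, sub_mul,
    mul_sub]
  abel

theorem opCoeff_conjDeriv_mul (m : ℕ) (u v : Zser k n K) :
    opCoeff (conjDeriv F) m (u * v) =
      opCoeff (conjDeriv F) m u * v + u * opCoeff (conjDeriv F) m v := by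
  rw [opCoeff_apply, constT_mul, conjDeriv_mul, coeffT_add, coeffT_mul_constT, coeffT_constT_mul]
  rfl

theorem ddt_opSeries_symm :
    ddt (opSeries F.symm.toLinearMap) =
      opSeries F.symm.toLinearMap * opSeries (conjDeriv F) := by
  rw [← opSeries_comp]
  ext1 m
  refine LinearMap.ext fun u => ?_
  rw [coeff_ddt, coeff_opSeries, coeff_opSeries, LinearMap.smul_apply, opCoeff_apply, opCoeff_apply,
    LinearMap.comp_apply, conjDeriv_apply, derivT_constT, sub_zero]
  simp only [AlgEquiv.toLinearMap_apply, AlgEquiv.symm_apply_apply]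
  rw [coeffT_derivT]

theorem ddt_opSeries :
    ddt (opSeries F.toLinearMap) = -(opSeries (conjDeriv F) * opSeries F.toLinearMap) := by
  rw [← opSeries_comp]
  ext1 m
  refine LinearMap.ext fun u => ?_
  rw [map_neg, coeff_ddt, coeff_opSeries, coeff_opSeries, LinearMap.smul_apply, LinearMap.neg_apply,
    opCoeff_apply, opCoeff_apply, LinearMap.comp_apply, conjDeriv_apply]
  simp only [AlgEquiv.toLinearMap_apply, AlgEquiv.symm_apply_apply]
  rw [derivT_constT, map_zero, zero_sub, coeffT_neg, neg_neg, coeffT_derivT]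

end OpSeries

namespace AutT

variable {k : VarKind} {n : ℕ} {K : Type*} [CommRing K] {α : ℕ} (F : AutT k n K α)

theorem toAlgEquiv_zvar (i : Fin n) : F.toAlgEquiv (zvar i) = zvar i - F.H i := by
  rw [H, sub_sub_cancel]

theorem symm_zvar (i : Fin n) : F.toAlgEquiv.symm (zvar i) = zvar i + F.M i := by
  rw [M, add_sub_cancel]

theorem M_eq (i : Fin n) : F.M i = F.toAlgEquiv.symm (F.H i) := by
  rw [M, H, map_sub, AlgEquiv.symm_apply_apply]

theorem ordGE_apply_zvar (hα : 1 ≤ α) (i : Fin n) :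
    OrdGE 1 ((F.toAlgEquiv : Zsert k n K →ₐ[PowerSeries K] Zsert k n K) (zvar i)) := by
  change OrdGE 1 (F.toAlgEquiv (zvar i))
  have h : OrdGE 1 (F.H i) := (F.ordGE i).mono hα
  rw [ordGE_one_iff] at h ⊢
  rw [toAlgEquiv_zvar]
  change (zvar i : Zsert k n K) 0 - F.H i 0 = 0
  rw [h, ordGE_one_iff.1 (ordGE_one_zvar i), sub_zero]

theorem ordGE_apply (hα : 1 ≤ α) {m : ℕ} {u : Zsert k n K} (hu : OrdGE m u) :
    OrdGE m (F.toAlgEquiv u) :=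
  AlgHom.ordGE_apply (F.ordGE_apply_zvar hα) m hu

theorem ordGE_symm_apply (hα : 1 ≤ α) {m : ℕ} {u : Zsert k n K} (hu : OrdGE m u) :
    OrdGE m (F.toAlgEquiv.symm u) := by
  refine AlgHom.ordGE_apply
    (F := (F.toAlgEquiv.symm : Zsert k n K →ₐ[PowerSeries K] Zsert k n K)) (fun i => ?_) m hu
  refine ordGE_one_iff.2 ((AlgHom.apply_apply_zero (F.ordGE_apply_zvar hα) _).symm.trans ?_)
  change F.toAlgEquiv (F.toAlgEquiv.symm (zvar i)) 0 = 0
  rw [AlgEquiv.apply_symm_apply, ordGE_one_iff.1 (ordGE_one_zvar i)]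

/-- An algebra endomorphism which fixes the variables at `t = 0` is the identity at `t = 0`. -/
theorem _root_.opCoeff_zero_eq_one (E : Zsert k n K ≃ₐ[PowerSeries K] Zsert k n K)
    (h : ∀ i, coeffT 0 (E (zvar i)) = zvar i) : opCoeff E.toLinearMap 0 = 1 := by
  let E₀ : Zser k n K →ₐ[K] Zser k n K :=
    AlgHom.ofLinearMap (opCoeff E.toLinearMap 0)
      (by rw [opCoeff_apply, constT_one]
          change coeffT 0 (E 1) = 1
          rw [map_one, ← constT_one, coeffT_zero_constT])
      (fun u v => by
        rw [opCoeff_apply, constT_mul]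
        change coeffT 0 (E (_ * _)) = _
        rw [map_mul, coeffT_zero_mul]
        rfl)
  refine LinearMap.ext fun u => AlgHom.eq_id_of_zvar (F := E₀) (fun i => ?_) u
  change coeffT 0 (E (constT (zvar i))) = _
  rw [constT_zvar, h]

theorem opCoeff_zero : opCoeff F.toAlgEquiv.toLinearMap 0 = 1 := by
  refine opCoeff_zero_eq_one _ fun i => ?_
  have h : coeffT 0 (F.H i) = 0 := F.at_zero i
  rw [toAlgEquiv_zvar, coeffT_sub, h, sub_zero, ← constT_zvar, coeffT_zero_constT]

theorem opSeries_mul_opSeries_symm :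
    opSeries F.toAlgEquiv.toLinearMap * opSeries F.toAlgEquiv.symm.toLinearMap = 1 := by
  rw [← opSeries_comp, ← opSeries_id]
  congr 1
  exact LinearMap.ext F.toAlgEquiv.apply_symm_apply

theorem opSeries_symm_mul_opSeries :
    opSeries F.toAlgEquiv.symm.toLinearMap * opSeries F.toAlgEquiv.toLinearMap = 1 := by
  rw [← opSeries_comp, ← opSeries_id]
  congr 1
  exact LinearMap.ext F.toAlgEquiv.symm_apply_apply

theorem opCoeff_symm_zero : opCoeff F.toAlgEquiv.symm.toLinearMap 0 = 1 := by
  have h := congrArg (PowerSeries.coeff 0) F.opSeries_mul_opSeries_symm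
  rw [PowerSeries.coeff_mul, Finset.Nat.antidiagonal_zero, Finset.sum_singleton, coeff_opSeries,
    coeff_opSeries, F.opCoeff_zero, one_mul] at h
  rw [h]
  simp

theorem opCoeff_conjDeriv_zvar (m : ℕ) (i : Fin n) :
    opCoeff (conjDeriv F.toAlgEquiv) m (zvar i) = coeffT m (F.toAlgEquiv (derivT (F.M i))) := by
  rw [opCoeff_apply, constT_zvar, conjDeriv_apply, symm_zvar, derivT_add, ← constT_zvar,
    derivT_constT, zero_add, sub_zero]

theorem opCoeff_conjDeriv_symm_zvar (m : ℕ) (i : Fin n) :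
    opCoeff (conjDeriv F.toAlgEquiv.symm) m (zvar i) =
      -coeffT m (F.toAlgEquiv.symm (derivT (F.H i))) := by
  rw [opCoeff_apply, constT_zvar, conjDeriv_apply, AlgEquiv.symm_symm, toAlgEquiv_zvar, derivT_sub,
    ← constT_zvar, derivT_constT, zero_sub, sub_zero, map_neg, coeffT_neg]

/-- The coefficients of `F ∘ ∂/∂t ∘ F⁻¹ - ∂/∂t`. -/
def psiDer (hα : 1 ≤ α) (m : ℕ) : DerLie k n K α :=
  ⟨opCoeff (conjDeriv F.toAlgEquiv) m, opCoeff_conjDeriv_mul _ m,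
    ordGE_of_leibniz hα (opCoeff_conjDeriv_mul _ m) fun i => by
      rw [opCoeff_conjDeriv_zvar]
      refine ((F.ordGE_apply hα (OrdGE.derivT ?_)).coeffT m)
      rw [M_eq]
      exact F.ordGE_symm_apply hα (F.ordGE i)⟩

end AutT

theorem DerLie.ext_zvar {k : VarKind} {n : ℕ} {K : Type*} [CommRing K] {α : ℕ}
    {δ δ' : DerLie k n K α}
    (h : ∀ i, (δ : Module.End K (Zser k n K)) (zvar i) = (δ' : Module.End K (Zser k n K)) (zvar i)) :
    δ = δ' :=
  Subtype.ext (eq_of_leibniz_of_zvar δ.2.1 δ'.2.1 h)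

theorem DerLie.ordGE_apply_zvar {k : VarKind} {n : ℕ} {K : Type*} [CommRing K] {α : ℕ} (hα : 1 ≤ α)
    (δ : DerLie k n K α) (i : Fin n) : OrdGE α ((δ : Module.End K (Zser k n K)) (zvar i)) :=
  (δ.2.2 1 _ (ordGE_one_zvar i)).mono (by omega)

end

noncomputable section

open Finset.HasAntidiagonal (antidiagonal mem_antidiagonal)

section Primitive

theorem counit_eq_zero_of_primitive {K A : Type*} [CommRing K] [Ring A] [Bialgebra K A] {x : A}
    (hx : Coalgebra.comul (R := K) x = 1 ⊗ₜ[K] x + x ⊗ₜ[K] 1) :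
    Coalgebra.counit (R := K) x = 0 := by
  have h := Coalgebra.rTensor_counit_comul (R := K) x
  rw [hx, map_add, LinearMap.rTensor_tmul, LinearMap.rTensor_tmul, Bialgebra.counit_one,
    add_eq_left] at h
  have h' := congrArg (LinearMap.mul' K K ∘ₗ LinearMap.lTensor K (Coalgebra.counit (R := K) (A := A))) h
  simpa using h'

theorem antipode_eq_neg_of_primitive {K A : Type*} [CommRing K] [Ring A] [HopfAlgebra K A] {x : A}
    (hx : Coalgebra.comul (R := K) x = 1 ⊗ₜ[K] x + x ⊗ₜ[K] 1) :
    HopfAlgebra.antipode K x = -x := by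
  have h := HopfAlgebra.mul_antipode_rTensor_comul_apply (R := K) x
  rw [hx, counit_eq_zero_of_primitive hx] at h
  simp only [map_add, LinearMap.rTensor_tmul, LinearMap.mul'_apply, HopfAlgebra.antipode_one,
    one_mul, mul_one, map_zero] at h
  exact eq_neg_of_add_eq_zero_right h

end Primitive

section InitialValueProblem

variable (K : Type*) {A : Type*} [CommRing K] [Algebra ℚ K] [Ring A] [Algebra K A]

/-- The coefficients of the solution of `g' = g p`, `g(0) = 1`. -/
def odeCoeff (p : PowerSeries A) : ℕ → A
  | 0 => 1
  | m + 1 => algebraMap ℚ K (1 / ((m + 1 : ℕ) : ℚ)) •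
      ∑ i : Fin (m + 1), odeCoeff p i * PowerSeries.coeff (m - i) p

theorem exists_ddt_eq_mul (K : Type*) {A : Type*} [CommRing K] [Algebra ℚ K] [Ring A]
    [Algebra K A] (p : PowerSeries A) :
    ∃ g : PowerSeries A, PowerSeries.constantCoeff g = 1 ∧ ddt g = g * p := by
  refine ⟨PowerSeries.mk (odeCoeff K p), ?_, ?_⟩
  · rw [← PowerSeries.coeff_zero_eq_constantCoeff_apply, PowerSeries.coeff_mk, odeCoeff]
  · ext m
    rw [coeff_ddt, PowerSeries.coeff_mk, odeCoeff, ← smul_comm,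
      invNat_smul_nsmul K (m := m + 1) m.succ_pos, PowerSeries.coeff_mul,
      Finset.Nat.sum_antidiagonal_eq_sum_range_succ_mk]
    simp_rw [PowerSeries.coeff_mk]
    exact Fin.sum_univ_eq_sum_range (fun i => odeCoeff K p i * PowerSeries.coeff (m - i) p) (m + 1)

end InitialValueProblem

theorem negT_negT {A : Type*} [Ring A] (f : PowerSeries A) : negT (negT f) = f := by
  ext m
  rw [negT, negT, PowerSeries.coeff_mk, PowerSeries.coeff_mk, ← mul_assoc, ← pow_add, ← two_mul,
    pow_mul]
  simp

namespace NSym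

variable {K : Type*} [CommRing K]

theorem ddt_sigma : ddt (sigma K) = sigma K * psi K := by
  rw [psi, ← mul_assoc, sigma_mul_negT_lam, one_mul]

theorem ddt_sigma' : ddt (sigma K) = xi K * sigma K := by
  rw [xi, mul_assoc, negT_lam_mul_sigma, mul_one]

theorem coeff_lam (m : ℕ) : PowerSeries.coeff m (lam K) = Lam K m := PowerSeries.coeff_mk _ _

theorem coeff_sigma (m : ℕ) : PowerSeries.coeff m (sigma K) = Sm K m := rfl

theorem coeff_psi (m : ℕ) : PowerSeries.coeff m (psi K) = Psi K m.succPNat := rfl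

theorem coeff_xi (m : ℕ) : PowerSeries.coeff m (xi K) = Xi K m.succPNat := rfl

theorem coeff_phi [Algebra ℚ K] (m : ℕ+) : PowerSeries.coeff (m : ℕ) (phi K) =
    algebraMap ℚ K (1 / (m : ℕ)) • Phi K m := (invNat_smul_nsmul K m.pos _).symm

section Hom

variable {A : Type*} [Ring A] [Algebra K A]

theorem hom_ext_Lam {S S' : NSym K →ₐ[K] A} (h : ∀ m : ℕ+, S (Lam K m) = S' (Lam K m)) :
    S = S' :=
  FreeAlgebra.hom_ext (funext fun m => by
    have := h m
    rwa [Lam_pos] at this)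

theorem map_ddt_sigma (S : NSym K →ₐ[K] A) :
    ddt (PowerSeries.map S.toRingHom (sigma K)) =
      PowerSeries.map S.toRingHom (sigma K) * PowerSeries.map S.toRingHom (psi K) := by
  rw [← map_ddt, ddt_sigma, map_mul]

theorem constantCoeff_map_sigma (S : NSym K →ₐ[K] A) :
    PowerSeries.constantCoeff (PowerSeries.map S.toRingHom (sigma K)) = 1 := by
  rw [← PowerSeries.coeff_zero_eq_constantCoeff_apply, PowerSeries.coeff_map,
    PowerSeries.coeff_zero_eq_constantCoeff_apply, constantCoeff_sigma, map_one]

theorem map_negT_lam_mul_map_sigma (S : NSym K →ₐ[K] A) :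
    negT (PowerSeries.map S.toRingHom (lam K)) * PowerSeries.map S.toRingHom (sigma K) = 1 := by
  rw [← map_negT, ← map_mul, negT_lam_mul_sigma, map_one]

theorem map_sigma_mul_map_negT_lam (S : NSym K →ₐ[K] A) :
    PowerSeries.map S.toRingHom (sigma K) * negT (PowerSeries.map S.toRingHom (lam K)) = 1 := by
  rw [← map_negT, ← map_mul, sigma_mul_negT_lam, map_one]

variable [Algebra ℚ K]

/-- The power sums `Ψ_m` generate the algebra `NSym`. -/
theorem hom_ext_Psi {S S' : NSym K →ₐ[K] A} (h : ∀ m : ℕ+, S (Psi K m) = S' (Psi K m)) :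
    S = S' := by
  have hpsi : PowerSeries.map S.toRingHom (psi K) = PowerSeries.map S'.toRingHom (psi K) := by
    ext m
    exact h m.succPNat
  have hs : PowerSeries.map S.toRingHom (sigma K) = PowerSeries.map S'.toRingHom (sigma K) :=
    eq_of_ddt_eq_mul K (map_ddt_sigma S) (by rw [map_ddt_sigma, hpsi])
      (by rw [constantCoeff_map_sigma, constantCoeff_map_sigma])
  have hl : negT (PowerSeries.map S.toRingHom (lam K)) =
      negT (PowerSeries.map S'.toRingHom (lam K)) :=
    left_inv_eq_right_inv (map_negT_lam_mul_map_sigma S) (hs ▸ map_sigma_mul_map_negT_lam S')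
  have hl' := congrArg negT hl
  rw [negT_negT, negT_negT] at hl'
  refine hom_ext_Lam fun m => ?_
  have := congrArg (PowerSeries.coeff (m : ℕ)) hl'
  rwa [PowerSeries.coeff_map, PowerSeries.coeff_map, coeff_lam] at this

/-- The power sums `Ψ_m` are free generators of `NSym`. -/
theorem exists_algHom_Psi (p : ℕ+ → A) : ∃ S : NSym K →ₐ[K] A, ∀ m, S (Psi K m) = p m := by
  obtain ⟨g, hg0, hg⟩ := exists_ddt_eq_mul K (PowerSeries.mk fun m => p m.succPNat)
  obtain ⟨f, hfg, hgf⟩ : ∃ f, f * g = 1 ∧ g * f = 1 :=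
    ⟨_, PowerSeries.invOfUnit_mul g 1 hg0, PowerSeries.mul_invOfUnit g 1 hg0⟩
  have hf0 : PowerSeries.coeff 0 f = 1 := by
    have := congrArg PowerSeries.constantCoeff hfg
    rwa [map_mul, hg0, mul_one, map_one, ← PowerSeries.coeff_zero_eq_constantCoeff_apply] at this
  let S : NSym K →ₐ[K] A := FreeAlgebra.lift K fun m : ℕ+ => PowerSeries.coeff (m : ℕ) (negT f)
  have hl : PowerSeries.map S.toRingHom (lam K) = negT f := by
    ext m
    rw [PowerSeries.coeff_map, coeff_lam]
    change S (Lam K m) = _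
    rcases Nat.eq_zero_or_pos m with rfl | hm
    · rw [Lam_zero, map_one, negT, PowerSeries.coeff_mk, hf0, pow_zero, one_mul]
    · obtain ⟨m, rfl⟩ : ∃ m' : ℕ+, (m' : ℕ) = m := ⟨m.toPNat hm, rfl⟩
      rw [Lam_pos, FreeAlgebra.lift_ι_apply]
  have hs : PowerSeries.map S.toRingHom (sigma K) = g := by
    have h := map_negT_lam_mul_map_sigma S
    rw [hl, negT_negT] at h
    exact (left_inv_eq_right_inv hgf h).symm
  have hp : PowerSeries.map S.toRingHom (psi K) = PowerSeries.mk fun m => p m.succPNat := by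
    rw [psi, map_mul, map_negT, map_ddt, hs, hl, negT_negT, hg, ← mul_assoc, hfg, one_mul]
  refine ⟨S, fun m => ?_⟩
  have h := congrArg (PowerSeries.coeff m.natPred) hp
  rw [PowerSeries.coeff_map, PowerSeries.coeff_mk, PNat.succPNat_natPred] at h
  exact h

end Hom

section PrimitiveSeries

/-- The embedding `x ↦ x ⊗ 1` of `NSym` in `NSym ⊗ NSym`. -/
abbrev inl : NSym K →ₐ[K] NSym K ⊗[K] NSym K := Algebra.TensorProduct.includeLeft

/-- The embedding `x ↦ 1 ⊗ x` of `NSym` in `NSym ⊗ NSym`. -/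
abbrev inr : NSym K →ₐ[K] NSym K ⊗[K] NSym K := Algebra.TensorProduct.includeRight

theorem commute_map_inl_map_inr (f g : PowerSeries (NSym K)) :
    Commute (PowerSeries.map (inl (K := K)).toRingHom f)
      (PowerSeries.map (inr (K := K)).toRingHom g) := by
  ext1 m
  rw [PowerSeries.coeff_mul, PowerSeries.coeff_mul, ← Finset.Nat.sum_antidiagonal_swap]
  refine Finset.sum_congr rfl fun p _ => ?_
  simp [inl, inr]

theorem comul_coeff_of_map_eq {f : PowerSeries (NSym K)}
    (h : PowerSeries.map (comulHom (K := K)).toRingHom f =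
      PowerSeries.map (inl (K := K)).toRingHom f + PowerSeries.map (inr (K := K)).toRingHom f)
    (m : ℕ) : Coalgebra.comul (R := K) (PowerSeries.coeff m f) =
      1 ⊗ₜ[K] PowerSeries.coeff m f + PowerSeries.coeff m f ⊗ₜ[K] 1 := by
  have := congrArg (PowerSeries.coeff m) h
  rw [PowerSeries.coeff_map, map_add, PowerSeries.coeff_map, PowerSeries.coeff_map, add_comm] at this
  exact this

theorem map_comulHom_psi : PowerSeries.map (comulHom (K := K)).toRingHom (psi K) =
    PowerSeries.map (inl (K := K)).toRingHom (psi K) +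
      PowerSeries.map (inr (K := K)).toRingHom (psi K) := by
  ext m
  rw [PowerSeries.coeff_map, map_add, PowerSeries.coeff_map, PowerSeries.coeff_map, add_comm]
  exact comul_Psi m.succPNat

theorem ddt_map_inl_mul_map_inr_sigma :
    ddt (PowerSeries.map (inl (K := K)).toRingHom (sigma K) *
        PowerSeries.map (inr (K := K)).toRingHom (sigma K)) =
      PowerSeries.map (inl (K := K)).toRingHom (ddt (sigma K)) *
        PowerSeries.map (inr (K := K)).toRingHom (sigma K) +
      PowerSeries.map (inl (K := K)).toRingHom (sigma K) *
        PowerSeries.map (inr (K := K)).toRingHom (ddt (sigma K)) := by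
  rw [ddt_mul, map_ddt, map_ddt]

variable [Algebra ℚ K]

theorem map_comulHom_sigma : PowerSeries.map (comulHom (K := K)).toRingHom (sigma K) =
    PowerSeries.map (inl (K := K)).toRingHom (sigma K) *
      PowerSeries.map (inr (K := K)).toRingHom (sigma K) := by
  refine eq_of_ddt_eq_mul K (map_ddt_sigma _) ?_ ?_
  · rw [ddt_map_inl_mul_map_inr_sigma, map_comulHom_psi, ddt_sigma, map_mul, map_mul, mul_add,
      mul_assoc, (commute_map_inl_map_inr _ _).eq, ← mul_assoc, ← mul_assoc]
  · rw [map_mul, constantCoeff_map_sigma, constantCoeff_map_sigma, constantCoeff_map_sigma, one_mul]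

theorem map_comulHom_xi : PowerSeries.map (comulHom (K := K)).toRingHom (xi K) =
    PowerSeries.map (inl (K := K)).toRingHom (xi K) +
      PowerSeries.map (inr (K := K)).toRingHom (xi K) := by
  have h : PowerSeries.map (comulHom (K := K)).toRingHom (xi K) *
        PowerSeries.map (comulHom (K := K)).toRingHom (sigma K) =
      (PowerSeries.map (inl (K := K)).toRingHom (xi K) +
        PowerSeries.map (inr (K := K)).toRingHom (xi K)) *
        PowerSeries.map (comulHom (K := K)).toRingHom (sigma K) := by
    rw [← map_mul, ← ddt_sigma', map_ddt, map_comulHom_sigma, ddt_map_inl_mul_map_inr_sigma,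
      ddt_sigma', map_mul, map_mul, add_mul]
    congr 1
    · rw [mul_assoc]
    · rw [← mul_assoc, (commute_map_inl_map_inr _ _).eq, mul_assoc]
  have h' := congrArg (· * negT (PowerSeries.map (comulHom (K := K)).toRingHom (lam K))) h
  simpa only [mul_assoc, map_sigma_mul_map_negT_lam, mul_one] using h'

theorem constantCoeff_map_phi {A : Type*} [Ring A] [Algebra K A] (S : NSym K →ₐ[K] A) :
    PowerSeries.constantCoeff (PowerSeries.map S.toRingHom (phi K)) = 0 := by
  rw [← PowerSeries.coeff_zero_eq_constantCoeff_apply, PowerSeries.coeff_map,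
    PowerSeries.coeff_zero_eq_constantCoeff_apply, phi, constantCoeff_logT, map_zero]

theorem expT_map_phi {A : Type*} [Ring A] [Algebra K A] (S : NSym K →ₐ[K] A) :
    expT K (PowerSeries.map S.toRingHom (phi K)) = PowerSeries.map S.toRingHom (sigma K) := by
  rw [← map_expT, phi, expT_logT constantCoeff_sigma]

theorem map_comulHom_phi : PowerSeries.map (comulHom (K := K)).toRingHom (phi K) =
    PowerSeries.map (inl (K := K)).toRingHom (phi K) +
      PowerSeries.map (inr (K := K)).toRingHom (phi K) := by
  refine expT_injective K (constantCoeff_map_phi _)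
    (by rw [map_add, constantCoeff_map_phi, constantCoeff_map_phi, add_zero]) ?_
  rw [expT_add K (constantCoeff_map_phi _) (constantCoeff_map_phi _)
    (commute_map_inl_map_inr _ _), expT_map_phi, expT_map_phi, expT_map_phi, map_comulHom_sigma]

/-- The power sums `Ξ_m` are primitive. -/
theorem comul_Xi (m : ℕ+) :
    Coalgebra.comul (R := K) (Xi K m) = 1 ⊗ₜ[K] Xi K m + Xi K m ⊗ₜ[K] 1 :=
  comul_coeff_of_map_eq map_comulHom_xi _

/-- The power sums `Φ_m` are primitive. -/
theorem comul_Phi (m : ℕ+) :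
    Coalgebra.comul (R := K) (Phi K m) = 1 ⊗ₜ[K] Phi K m + Phi K m ⊗ₜ[K] 1 := by
  rw [Phi, map_nsmul, comul_coeff_of_map_eq map_comulHom_phi, smul_add, TensorProduct.tmul_smul,
    ← TensorProduct.smul_tmul']

/-- An algebra homomorphism which sends the `Ψ_m` to primitive elements respects coproducts. -/
theorem apply_eq_map_comul {B : Type*} [Ring B] [Algebra K B] (S : NSym K →ₐ[K] B)
    (Δ : B →ₐ[K] B ⊗[K] B)
    (h : ∀ m, Δ (S (Psi K m)) = 1 ⊗ₜ[K] S (Psi K m) + S (Psi K m) ⊗ₜ[K] 1) (x : NSym K) :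
    Δ (S x) = Algebra.TensorProduct.map S S (Coalgebra.comul (R := K) x) := by
  have e : Δ.comp S = (Algebra.TensorProduct.map S S).comp (Bialgebra.comulAlgHom K (NSym K)) := by
    refine hom_ext_Psi fun m => ?_
    rw [AlgHom.comp_apply, AlgHom.comp_apply, h, Bialgebra.comulAlgHom_apply, comul_Psi, map_add,
      Algebra.TensorProduct.map_tmul, Algebra.TensorProduct.map_tmul, map_one]
  exact DFunLike.congr_fun e x

end PrimitiveSeries

end NSym

end

noncomputable section

open Finset.HasAntidiagonal (antidiagonal mem_antidiagonal)

attribute [local instance 100] LieRing.ofAssociativeRing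

section Env

variable {k : VarKind} {n : ℕ} {K : Type*} [CommRing K] {α : ℕ}

theorem envAction_derEnv (δ : DerLie k n K α) :
    envAction k n K α (derEnv k n K α δ) = derIncl k n K α δ :=
  UniversalEnvelopingAlgebra.lift_ι_apply K (derIncl k n K α) δ

theorem derIncl_injective : Function.Injective (derIncl k n K α) := fun _ _ h =>
  Subtype.ext (congrArg (fun D : DiffOp k n K α => (D : Module.End K (Zser k n K))) h)

theorem comul_derEnv (δ : DerLie k n K α) : Coalgebra.comul (R := K) (derEnv k n K α δ) =
    1 ⊗ₜ[K] derEnv k n K α δ + derEnv k n K α δ ⊗ₜ[K] 1 :=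
  UniversalEnvelopingAlgebra.comul_ι K _ δ

/-- An algebra homomorphism from `NSym` to an enveloping algebra which sends the `Ψ_m` to elements
of the Lie algebra is a bialgebra homomorphism. -/
theorem exists_bialgHom_Psi [Algebra ℚ K] (p : ℕ+ → DerLie k n K α) :
    ∃ T : NSym K →ₐc[K] EnvDer k n K α, ∀ m, T (NSym.Psi K m) = derEnv k n K α (p m) := by
  obtain ⟨T₀, hT₀⟩ := NSym.exists_algHom_Psi (K := K) fun m => derEnv k n K α (p m)
  refine ⟨BialgHom.ofAlgHom T₀ (NSym.hom_ext_Psi fun m => ?_) (NSym.hom_ext_Psi fun m => ?_), hT₀⟩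
  · rw [AlgHom.comp_apply, hT₀, Bialgebra.counitAlgHom_apply, Bialgebra.counitAlgHom_apply,
      counit_eq_zero_of_primitive (NSym.comul_Psi m), counit_eq_zero_of_primitive (comul_derEnv _)]
  · rw [AlgHom.comp_apply, AlgHom.comp_apply, hT₀, Bialgebra.comulAlgHom_apply,
      Bialgebra.comulAlgHom_apply, NSym.comul_Psi, comul_derEnv, map_add,
      Algebra.TensorProduct.map_tmul, Algebra.TensorProduct.map_tmul, map_one, hT₀]

theorem exists_derEnv_eq [Algebra ℚ K] (T : NSym K →ₐc[K] EnvDer k n K α) {x : NSym K}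
    (hx : Coalgebra.comul (R := K) x = 1 ⊗ₜ[K] x + x ⊗ₜ[K] 1) :
    ∃ δ : DerLie k n K α, derEnv k n K α δ = T x := by
  refine UniversalEnvelopingAlgebra.exists_ι_eq_of_primitive ?_
  rw [← CoalgHomClass.map_comp_comul_apply, hx, map_add, TensorProduct.map_tmul,
    TensorProduct.map_tmul]
  simp

end Env

theorem coeff_hSeries {k : VarKind} {n : ℕ} {K : Type*} [CommRing K] {α : ℕ}
    (δ : ℕ+ → DerLie k n K α) (m : ℕ) :
    PowerSeries.coeff m (hSeries δ) = derIncl k n K α (δ m.succPNat) :=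
  PowerSeries.coeff_mk _ _

theorem hSeries_eq_map_psi {k : VarKind} {n : ℕ} {K : Type*} [CommRing K] {α : ℕ}
    {S : NSym K →ₐ[K] DiffOp k n K α} {ψ : ℕ+ → DerLie k n K α}
    (h : ∀ m, S (NSym.Psi K m) = derIncl k n K α (ψ m)) :
    hSeries ψ = PowerSeries.map S.toRingHom (NSym.psi K) := by
  ext1 m
  rw [coeff_hSeries, ← h]
  rfl

theorem hSeries_eq_map_xi {k : VarKind} {n : ℕ} {K : Type*} [CommRing K] {α : ℕ}
    {S : NSym K →ₐ[K] DiffOp k n K α} {ξ : ℕ+ → DerLie k n K α}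
    (h : ∀ m, S (NSym.Xi K m) = derIncl k n K α (ξ m)) :
    hSeries ξ = PowerSeries.map S.toRingHom (NSym.xi K) := by
  ext1 m
  rw [coeff_hSeries, ← h]
  rfl

section Omega

variable {k : VarKind} {n : ℕ} {K : Type*} [CommRing K] [Algebra ℚ K] {α : ℕ}

theorem coeff_dSeries_zero (φ : ℕ+ → DerLie k n K α) :
    PowerSeries.coeff 0 (dSeries φ) = 0 := by
  rw [dSeries, PowerSeries.coeff_mk, dif_neg (lt_irrefl 0)]

theorem coeff_dSeries (φ : ℕ+ → DerLie k n K α) (m : ℕ+) :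
    PowerSeries.coeff (m : ℕ) (dSeries φ) =
      algebraMap ℚ K (1 / (m : ℕ)) • derIncl k n K α (φ m) := by
  rw [dSeries, PowerSeries.coeff_mk, dif_pos m.pos]
  rfl

theorem constantCoeff_dSeries (φ : ℕ+ → DerLie k n K α) :
    PowerSeries.constantCoeff (dSeries φ) = 0 := by
  rw [← PowerSeries.coeff_zero_eq_constantCoeff_apply, coeff_dSeries_zero]

theorem dSeries_eq_map_phi {S : NSym K →ₐ[K] DiffOp k n K α} {φ : ℕ+ → DerLie k n K α}
    (h : ∀ m, S (NSym.Phi K m) = derIncl k n K α (φ m)) :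
    dSeries φ = PowerSeries.map S.toRingHom (NSym.phi K) := by
  ext1 m
  rcases Nat.eq_zero_or_pos m with rfl | hm
  · rw [coeff_dSeries_zero, PowerSeries.coeff_zero_eq_constantCoeff_apply,
      NSym.constantCoeff_map_phi]
  · obtain ⟨m, rfl⟩ : ∃ m' : ℕ+, (m' : ℕ) = m := ⟨m.toPNat hm, rfl⟩
    rw [coeff_dSeries, PowerSeries.coeff_map, NSym.coeff_phi, ← h]
    exact (map_smul S _ _).symm

variable {F : AutT k n K α}

namespace Omega

theorem lam_eq (Ω : Omega F) (m : ℕ) :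
    (Ω.lam m : Module.End K (Zser k n K)) = (-1 : K) ^ m • opCoeff F.toAlgEquiv.toLinearMap m := by
  refine LinearMap.ext fun u => ?_
  have h := Ω.lam_apply (constT u) m
  rw [Finset.sum_eq_single (m, 0)] at h
  · rw [coeffT_zero_constT] at h
    rw [LinearMap.smul_apply, opCoeff_apply]
    change _ = (-1 : K) ^ m • coeffT m (F.toAlgEquiv (constT u))
    rw [← h, smul_smul, ← mul_pow]
    simp
  · rintro ⟨i, j⟩ hij hne
    rw [coeffT_constT, if_neg, map_zero, smul_zero]
    rintro rfl
    exact hne (Prod.ext (by simpa using mem_antidiagonal.1 hij) rfl)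
  · intro h'
    exact absurd (mem_antidiagonal.2 (add_zero m)) h'

theorem s_eq (Ω : Omega F) (m : ℕ) :
    (Ω.s m : Module.End K (Zser k n K)) = opCoeff F.toAlgEquiv.symm.toLinearMap m := by
  refine LinearMap.ext fun u => ?_
  have h := Ω.s_apply (constT u) m
  rw [Finset.sum_eq_single (m, 0)] at h
  · rw [coeffT_zero_constT] at h
    exact h
  · rintro ⟨i, j⟩ hij hne
    rw [coeffT_constT, if_neg, map_zero]
    rintro rfl
    exact hne (Prod.ext (by simpa using mem_antidiagonal.1 hij) rfl)
  · intro h'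
    exact absurd (mem_antidiagonal.2 (add_zero m)) h'

theorem dSeries_phi_eq (Ω Ω' : Omega F) : dSeries Ω.phi = dSeries Ω'.phi := by
  ext1 m
  induction m using Nat.strong_induction_on with
  | _ m ih =>
    rcases Nat.eq_zero_or_pos m with rfl | hm
    · rw [coeff_dSeries_zero, coeff_dSeries_zero]
    obtain ⟨m, rfl⟩ : ∃ m' : ℕ+, (m' : ℕ) = m := ⟨m.toPNat hm, rfl⟩
    have h := coeff_expT_sub_coeff_expT K (x := -dSeries Ω.phi) (y := -dSeries Ω'.phi)
      (by rw [map_neg, constantCoeff_dSeries, neg_zero])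
      (by rw [map_neg, constantCoeff_dSeries, neg_zero]) (m := m)
      (fun i hi => by rw [map_neg, map_neg, ih i hi])
    rw [map_neg, map_neg, coeff_dSeries, coeff_dSeries] at h
    rw [coeff_dSeries, coeff_dSeries]
    have hφ : algebraMap ℚ K (1 / (m : ℕ)) • Ω.phi m = algebraMap ℚ K (1 / (m : ℕ)) • Ω'.phi m := by
      refine DerLie.ext_zvar fun i => ?_
      have hz := congrArg
        (fun D : DiffOp k n K α => (D : Module.End K (Zser k n K)) (zvar i)) h
      have e := (congrArg₂ (· - ·) (Ω.exp_dlog m i) (Ω'.exp_dlog m i)).trans (sub_self _)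
      have hz' := hz.symm.trans e
      change -(algebraMap ℚ K (1 / (m : ℕ)) • (Ω.phi m : Module.End K (Zser k n K)) (zvar i)) -
        -(algebraMap ℚ K (1 / (m : ℕ)) • (Ω'.phi m : Module.End K (Zser k n K)) (zvar i)) = 0 at hz'
      exact neg_injective (sub_eq_zero.1 hz')
    rw [← map_smul, hφ, map_smul]

theorem phi_eq (Ω Ω' : Omega F) : Ω.phi = Ω'.phi := by
  funext m
  have h := congrArg (PowerSeries.coeff (m : ℕ)) (dSeries_phi_eq Ω Ω')
  rw [coeff_dSeries, coeff_dSeries] at h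
  have h' := congrArg (fun x => (m : ℕ) • x) h
  simp only [smul_comm (m : ℕ) (algebraMap ℚ K (1 / (m : ℕ))), invNat_smul_nsmul K m.pos] at h'
  exact derIncl_injective h'

instance : Subsingleton (Omega F) := ⟨fun Ω Ω' => by
  have hphi := phi_eq Ω Ω'
  refine Omega.ext ?_ ?_ ?_ hphi ?_ ?_
  · exact funext fun m => Subtype.ext ((lam_eq Ω m).trans (lam_eq Ω' m).symm)
  · exact funext fun m => Subtype.ext ((s_eq Ω m).trans (s_eq Ω' m).symm)
  · refine funext fun i => coeffT_ext fun m => ?_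
    rcases Nat.eq_zero_or_pos m with rfl | hm
    · rw [Ω.dlog_zero, Ω'.dlog_zero]
    · obtain ⟨m, rfl⟩ : ∃ m' : ℕ+, (m' : ℕ) = m := ⟨m.toPNat hm, rfl⟩
      refine neg_injective ?_
      rw [← Ω.phi_apply, ← Ω'.phi_apply, hphi]
  · refine funext fun m => DerLie.ext_zvar fun i => ?_
    have h := (Ω.psi_apply m.natPred i).trans (Ω'.psi_apply m.natPred i).symm
    rwa [PNat.succPNat_natPred] at h
  · refine funext fun m => DerLie.ext_zvar fun i => ?_
    have h := (Ω.xi_apply m.natPred i).trans (Ω'.xi_apply m.natPred i).symm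
    rwa [PNat.succPNat_natPred] at h⟩

/-- The differential operators attached to `F_t` are the images of the noncommutative symmetric
functions under a bialgebra homomorphism. -/
theorem exists_bialgHom (hα : 1 ≤ α) (F : AutT k n K α) :
    ∃ (Ω : Omega F) (T : NSym K →ₐc[K] EnvDer k n K α),
      (∀ m, envAction k n K α (T (NSym.Lam K m)) = Ω.lam m) ∧
      (∀ m, envAction k n K α (T (NSym.Sm K m)) = Ω.s m) ∧
      (∀ m, T (NSym.Psi K m) = derEnv k n K α (Ω.psi m)) ∧
      (∀ m, T (NSym.Phi K m) = derEnv k n K α (Ω.phi m)) ∧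
      (∀ m, T (NSym.Xi K m) = derEnv k n K α (Ω.xi m)) := by
  obtain ⟨T, hT⟩ := exists_bialgHom_Psi fun m : ℕ+ => F.psiDer hα m.natPred
  choose φ hφ using fun m : ℕ+ => exists_derEnv_eq T (NSym.comul_Phi m)
  choose ξ hξ using fun m : ℕ+ => exists_derEnv_eq T (NSym.comul_Xi m)
  let S : NSym K →ₐ[K] DiffOp k n K α := (envAction k n K α).comp (T : NSym K →ₐ[K] EnvDer k n K α)
  have hSφ : ∀ m, S (NSym.Phi K m) = derIncl k n K α (φ m) := fun m =>
    (congrArg (envAction k n K α) (hφ m).symm).trans (envAction_derEnv _)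
  have hSξ : ∀ m, S (NSym.Xi K m) = derIncl k n K α (ξ m) := fun m =>
    (congrArg (envAction k n K α) (hξ m).symm).trans (envAction_derEnv _)
  let R : NSym K →ₐ[K] Module.End K (Zser k n K) := (DiffOp k n K α).val.comp S
  have hRpsi : PowerSeries.map R.toRingHom (NSym.psi K) = opSeries (conjDeriv F.toAlgEquiv) := by
    ext1 m
    rw [PowerSeries.coeff_map, NSym.coeff_psi, coeff_opSeries]
    change ((envAction k n K α (T (NSym.Psi K m.succPNat)) : DiffOp k n K α) :
      Module.End K (Zser k n K)) = _
    rw [hT, envAction_derEnv, Nat.natPred_succPNat]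
    rfl
  have hRs : PowerSeries.map R.toRingHom (NSym.sigma K) =
      opSeries F.toAlgEquiv.symm.toLinearMap := by
    refine eq_of_ddt_eq_mul K (NSym.map_ddt_sigma R) ?_ ?_
    · rw [hRpsi, ddt_opSeries_symm]
    · rw [NSym.constantCoeff_map_sigma, ← PowerSeries.coeff_zero_eq_constantCoeff_apply,
        coeff_opSeries, F.opCoeff_symm_zero]
  have hRl : negT (PowerSeries.map R.toRingHom (NSym.lam K)) =
      opSeries F.toAlgEquiv.toLinearMap :=
    left_inv_eq_right_inv (NSym.map_negT_lam_mul_map_sigma R)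
      (hRs ▸ F.opSeries_symm_mul_opSeries)
  have hRxi : PowerSeries.map R.toRingHom (NSym.xi K) =
      -opSeries (conjDeriv F.toAlgEquiv.symm) := by
    have h := ddt_opSeries F.toAlgEquiv.symm
    rw [NSym.xi, map_mul, NSym.map_ddt, NSym.map_negT, hRs, hRl, h, ← neg_mul, mul_assoc,
      F.opSeries_symm_mul_opSeries, mul_one]
  have hRlam : ∀ m, (-1 : K) ^ m • R (NSym.Lam K m) = opCoeff F.toAlgEquiv.toLinearMap m := by
    intro m
    have h := congrArg (PowerSeries.coeff m) hRl
    rw [coeff_opSeries, negT, PowerSeries.coeff_mk, PowerSeries.coeff_map, NSym.coeff_lam] at h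
    rw [← h, Algebra.smul_def, map_pow, map_neg, map_one]
    rfl
  have hRsm : ∀ m, R (NSym.Sm K m) = opCoeff F.toAlgEquiv.symm.toLinearMap m := by
    intro m
    have h := congrArg (PowerSeries.coeff m) hRs
    rwa [coeff_opSeries, PowerSeries.coeff_map, NSym.coeff_sigma] at h
  have hexp : expT K (-dSeries φ) = negT (PowerSeries.map S.toRingHom (NSym.lam K)) := by
    have h := expT_neg_mul_expT K (constantCoeff_dSeries φ)
    rw [dSeries_eq_map_phi hSφ, NSym.expT_map_phi] at h
    rw [dSeries_eq_map_phi hSφ]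
    exact left_inv_eq_right_inv h (NSym.map_sigma_mul_map_negT_lam S)
  have hdlog : ∀ i, ∃ a : Zsert k n K, coeffT 0 a = 0 ∧ ∀ m : ℕ+, coeffT m a =
      -(algebraMap ℚ K (1 / (m : ℕ)) • (φ m : Module.End K (Zser k n K)) (zvar i)) := by
    intro i
    let c : ℕ → Zser k n K := fun m => -((PowerSeries.coeff m (dSeries φ) : DiffOp k n K α) :
      Module.End K (Zser k n K)) (zvar i)
    have hc : ∀ m, coeffT m (fun w => PowerSeries.mk fun j => c j w : Zsert k n K) = c m :=
      fun m => FormalSeries.ext fun w => PowerSeries.coeff_mk _ _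
    refine ⟨fun w => PowerSeries.mk fun j => c j w, ?_, fun m => ?_⟩
    · rw [hc]
      simp only [c, coeff_dSeries_zero]
      exact neg_zero
    · rw [hc]
      simp only [c, coeff_dSeries]
      rfl
  choose a ha0 ha using hdlog
  refine ⟨⟨fun m => S (NSym.Lam K m), fun m => S (NSym.Sm K m), a, φ,
    fun m => F.psiDer hα m.natPred, ξ, ?_, ?_, ?_, ?_, ha0, ?_, ?_, ?_, ?_, ?_⟩, T, fun _ => rfl,
    fun _ => rfl, hT, fun m => (hφ m).symm, fun m => (hξ m).symm⟩
  · rw [NSym.Lam_zero, map_one]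
  · rw [NSym.Sm_zero, map_one]
  · intro u m
    refine (Finset.sum_congr rfl fun p _ => ?_).trans
      (coeffT_apply_eq_sum F.toAlgEquiv.toLinearMap m u).symm
    rw [← hRlam]
    rfl
  · intro u m
    refine (Finset.sum_congr rfl fun p _ => ?_).trans
      (coeffT_apply_eq_sum F.toAlgEquiv.symm.toLinearMap m u).symm
    rw [← hRsm]
    rfl
  · intro i w hw
    ext m
    change coeffT m (a i) w = 0
    rcases Nat.eq_zero_or_pos m with rfl | hm
    · rw [ha0]
      rfl
    · obtain ⟨m, rfl⟩ : ∃ m' : ℕ+, (m' : ℕ) = m := ⟨m.toPNat hm, rfl⟩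
      rw [ha]
      change -(algebraMap ℚ K (1 / (m : ℕ)) • (φ m : Module.End K (Zser k n K)) (zvar i) w) = 0
      rw [DerLie.ordGE_apply_zvar hα (φ m) i w hw, smul_zero, neg_zero]
  · intro m i
    rw [ha, neg_neg]
  · intro m i
    rw [hexp, ← constT_zvar, ← NSym.map_negT, PowerSeries.coeff_map]
    have h := congrArg (PowerSeries.coeff m) hRl
    rw [← NSym.map_negT, PowerSeries.coeff_map, coeff_opSeries] at h
    exact congrArg (fun D : Module.End K (Zser k n K) => D (zvar i)) h
  · intro m i
    rw [Nat.natPred_succPNat]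
    exact F.opCoeff_conjDeriv_zvar m i
  · intro m i
    have h := congrArg (PowerSeries.coeff m) hRxi
    rw [PowerSeries.coeff_map, NSym.coeff_xi, map_neg, coeff_opSeries] at h
    have h' : (ξ m.succPNat : Module.End K (Zser k n K)) =
        -opCoeff (conjDeriv F.toAlgEquiv.symm) m :=
      (congrArg (fun D : DiffOp k n K α => (D : Module.End K (Zser k n K)))
        (hSξ m.succPNat).symm).trans h
    rw [h', LinearMap.neg_apply, F.opCoeff_conjDeriv_symm_zvar, neg_neg]

theorem map_Pi_eq_tuple (Ω : Omega F) {S : NSym K →ₐ[K] DiffOp k n K α}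
    (hlam : ∀ m, S (NSym.Lam K m) = Ω.lam m) (hs : ∀ m, S (NSym.Sm K m) = Ω.s m)
    (hpsi : ∀ m, S (NSym.Psi K m) = derIncl k n K α (Ω.psi m))
    (hphi : ∀ m, S (NSym.Phi K m) = derIncl k n K α (Ω.phi m))
    (hxi : ∀ m, S (NSym.Xi K m) = derIncl k n K α (Ω.xi m)) :
    (NSym.Pi K).map S = Ω.tuple := by
  refine FiveTuple.ext ?_ ?_ (dSeries_eq_map_phi hphi).symm (hSeries_eq_map_psi hpsi).symm
    (hSeries_eq_map_xi hxi).symm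
  · ext1 m
    change PowerSeries.coeff m (PowerSeries.map S.toRingHom (NSym.lam K)) =
      PowerSeries.coeff m (PowerSeries.mk Ω.lam)
    rw [PowerSeries.coeff_map, NSym.coeff_lam, PowerSeries.coeff_mk]
    exact hlam m
  · ext1 m
    change PowerSeries.coeff m (PowerSeries.map S.toRingHom (NSym.sigma K)) =
      PowerSeries.coeff m (PowerSeries.mk Ω.s)
    rw [PowerSeries.coeff_map, NSym.coeff_sigma, PowerSeries.coeff_mk]
    exact hs m

theorem apply_Psi_of_map_Pi_eq (Ω : Omega F) {S : NSym K →ₐ[K] DiffOp k n K α}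
    (h : (NSym.Pi K).map S = Ω.tuple) (m : ℕ+) :
    S (NSym.Psi K m) = derIncl k n K α (Ω.psi m) := by
  have h' := congrArg (fun P => PowerSeries.coeff m.natPred P.h) h
  have e := coeff_hSeries Ω.psi m.natPred
  rw [PNat.succPNat_natPred] at e
  exact h'.trans e

end Omega

end Omega

end

theorem theorem3p12 {K : Type*} [CommRing K] [Algebra ℚ K] (k : VarKind) (n α : ℕ) (hα : 1 ≤ α)
    (F : AutT k n K α) :
    (∃! _Ω : Omega F, True) ∧
    ∀ Ω : Omega F,
      (∃ T : NSym K →ₐc[K] EnvDer k n K α,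
        (NSym.Pi K).map ((envAction k n K α).comp (T : NSym K →ₐ[K] EnvDer k n K α)) = Ω.tuple ∧
        (∀ T' : NSym K →ₐc[K] EnvDer k n K α,
          (NSym.Pi K).map ((envAction k n K α).comp (T' : NSym K →ₐ[K] EnvDer k n K α)) =
            Ω.tuple → T' = T) ∧
        (∀ x, T (HopfAlgebra.antipode K x) = HopfAlgebra.antipode K (T x)) ∧
        ∀ m : ℕ+,
          envAction k n K α (T (NSym.Lam K m)) = Ω.lam m ∧
          envAction k n K α (T (NSym.Sm K m)) = Ω.s m ∧
          T (NSym.Psi K m) = derEnv k n K α (Ω.psi m) ∧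
          T (NSym.Phi K m) = derEnv k n K α (Ω.phi m) ∧
          T (NSym.Xi K m) = derEnv k n K α (Ω.xi m)) ∧
      (∃ S : NSym K →ₐ[K] DiffOp k n K α,
        (NSym.Pi K).map S = Ω.tuple ∧
        (∀ S' : NSym K →ₐ[K] DiffOp k n K α, (NSym.Pi K).map S' = Ω.tuple → S' = S) ∧
        (∀ m : ℕ+,
          S (NSym.Lam K m) = Ω.lam m ∧
          S (NSym.Sm K m) = Ω.s m ∧
          S (NSym.Psi K m) = derIncl k n K α (Ω.psi m) ∧
          S (NSym.Phi K m) = derIncl k n K α (Ω.phi m) ∧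
          S (NSym.Xi K m) = derIncl k n K α (Ω.xi m)) ∧
        (∀ Δ : DiffOp k n K α →ₐ[K] DiffOp k n K α ⊗[K] DiffOp k n K α,
          (∀ δ, Δ (derIncl k n K α δ) =
            1 ⊗ₜ[K] derIncl k n K α δ + derIncl k n K α δ ⊗ₜ[K] 1) →
          ∀ x, Δ (S x) = Algebra.TensorProduct.map S S (Coalgebra.comul (R := K) x)) ∧
        (∀ ε : DiffOp k n K α →ₐ[K] K, (∀ δ, ε (derIncl k n K α δ) = 0) →
          ∀ x, ε (S x) = Coalgebra.counit (R := K) x) ∧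
        (∀ σ : DiffOp k n K α →ₐ[K] (DiffOp k n K α)ᵐᵒᵖ,
          (∀ δ, σ (derIncl k n K α δ) = MulOpposite.op (-derIncl k n K α δ)) →
          ∀ x, σ (S x) = MulOpposite.op (S (HopfAlgebra.antipode K x)))) := by
  obtain ⟨Ω₀, T, hlam, hs, hpsi, hphi, hxi⟩ := Omega.exists_bialgHom hα F
  refine ⟨⟨Ω₀, trivial, fun Ω _ => Subsingleton.elim Ω Ω₀⟩, fun Ω => ?_⟩
  obtain rfl : Ω₀ = Ω := Subsingleton.elim _ _
  let S : NSym K →ₐ[K] DiffOp k n K α := (envAction k n K α).comp (T : NSym K →ₐ[K] EnvDer k n K α)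
  have hS : ∀ {x δ}, T x = derEnv k n K α δ → S x = derIncl k n K α δ := fun {x δ} h =>
    (congrArg (envAction k n K α) h).trans (envAction_derEnv δ)
  have hPi : (NSym.Pi K).map S = Ω₀.tuple :=
    Ω₀.map_Pi_eq_tuple hlam hs (fun m => hS (hpsi m)) (fun m => hS (hphi m)) fun m => hS (hxi m)
  refine ⟨⟨T, hPi, fun T' hT' => ?_, fun x => ?_, fun m =>
    ⟨hlam m, hs m, hpsi m, hphi m, hxi m⟩⟩, ⟨S, hPi, fun S' hS' => ?_, fun m =>
    ⟨hlam m, hs m, hS (hpsi m), hS (hphi m), hS (hxi m)⟩, fun Δ hΔ x => ?_, fun ε hε x => ?_,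
    fun σ hσ x => ?_⟩⟩
  · have h : (T' : NSym K →ₐ[K] EnvDer k n K α) = T := by
      refine NSym.hom_ext_Psi (K := K) fun m => ?_
      obtain ⟨δ, hδ⟩ := exists_derEnv_eq T' (NSym.comul_Psi m)
      have h1 := Ω₀.apply_Psi_of_map_Pi_eq hT' m
      have h2 : derIncl k n K α δ = derIncl k n K α (Ω₀.psi m) := by
        rw [← h1, ← envAction_derEnv, hδ]
        rfl
      rw [derIncl_injective h2] at hδ
      exact hδ.symm.trans (hpsi m).symm
    exact BialgHom.ext fun x => DFunLike.congr_fun h x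
  · have h : (AlgHom.op (T : NSym K →ₐ[K] EnvDer k n K α)).comp NSym.antipodeHom =
        (UniversalEnvelopingAlgebra.lift K
          (UniversalEnvelopingAlgebra.antipodeLie K (DerLie k n K α))).comp
          (T : NSym K →ₐ[K] EnvDer k n K α) := by
      refine NSym.hom_ext_Psi (K := K) fun m => ?_
      change MulOpposite.op (T (HopfAlgebra.antipode K (NSym.Psi K m))) =
        UniversalEnvelopingAlgebra.lift K
          (UniversalEnvelopingAlgebra.antipodeLie K (DerLie k n K α)) (T (NSym.Psi K m))
      rw [antipode_eq_neg_of_primitive (NSym.comul_Psi m), map_neg, hpsi, derEnv,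
        UniversalEnvelopingAlgebra.lift_ι_apply]
      rfl
    exact congrArg MulOpposite.unop (DFunLike.congr_fun h x)
  · exact NSym.hom_ext_Psi (K := K) fun m =>
      (Ω₀.apply_Psi_of_map_Pi_eq hS' m).trans (hS (hpsi m)).symm
  · exact NSym.apply_eq_map_comul S Δ (fun m => by rw [hS (hpsi m), hΔ]) x
  · have h : ε.comp S = Bialgebra.counitAlgHom K (NSym K) := by
      apply NSym.hom_ext_Psi
      intro m
      rw [AlgHom.comp_apply, hS (hpsi m), hε, Bialgebra.counitAlgHom_apply,
        counit_eq_zero_of_primitive (NSym.comul_Psi m)]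
    exact DFunLike.congr_fun h x
  · have h : σ.comp S = (AlgHom.op S).comp NSym.antipodeHom := by
      refine NSym.hom_ext_Psi (K := K) fun m => ?_
      change σ (S (NSym.Psi K m)) = MulOpposite.op (S (HopfAlgebra.antipode K (NSym.Psi K m)))
      rw [antipode_eq_neg_of_primitive (NSym.comul_Psi m), map_neg, hS (hpsi m), hσ]
    exact DFunLike.congr_fun h x
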